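/- Let $T>0$ and let $W=(W_t)_{0\le t\le T}$ be a standard one-dimensional Brownian motion with $W_0=0$ on a probability space. For $N\ge 1$ and $0\le l\le N$ put $t_l=lT/N$; for $1\le l\le N$ put $\Delta W^N_l=W_{t_l}-W_{t_{l-1}}$, and let $\mathcal G^N_l=\sigma(\Delta W^N_1,\dots,\Delta W^N_l)$, with $\mathcal G^N_0$ trivial. For each $N\ge 1$ let $X^N=F_N(\Delta W^N_1,\dots,\Delta W^N_N)\in L^2(\mathcal G^N_N)$ belong to $\mathbb D^{(N)}_{2,2}$; that is, for every $l=1,\dots,N$ the distributional derivatives $\partial_l F_N$ and $\partial_l^2F_N$ on $\mathbb R^N$ are functions, and $\partial_l^mX^N:=(\partial_l^mF_N)(\Delta W^N_1,\dots,\Delta W^N_N)\in L^2$ for $m=1,2$. Put $D_t^2X^N=\partial_l^2X^N$ for $t_{l-1}\le t<t_l$. If $$\sup_{N\ge 1}\int_0^T\|D_t^2X^N\|_{L^2}^2\,dt<\infty,$$ then the error of the first-order discrete Clark–Ocone approximation lies in $L^2$ for every $N\ge1$, and $$\Big\|X^N-\Big\{\mathbf E[X^N]+\sum_{l=1}^N\mathbf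 E[\partial_lX^N\mid\mathcal G^N_{l-1}]\,\Delta W^N_l\Big\}\Big\|_{L^2}=O(N^{-1/2})\qquad(N\to\infty).$$ -/

import Mathlib

open MeasureTheory ProbabilityTheory Filter
open scoped ENNReal

namespace DiscreteClarkOcone

/-- `W` is a standard one-dimensional Brownian motion on `[0, T]` under `P`, started at `0`
(only the values `W t` with `t ∈ [0, T]` are relevant). -/
structure IsBrownianMotionOn {Ω : Type*} [MeasurableSpace Ω] (T : ℝ) (W : ℝ → Ω → ℝ)
    (P : Measure Ω) : Prop where
  measurable : ∀ t ∈ Set.Icc 0 T, Measurable (W t)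
  start_zero : ∀ᵐ ω ∂P, W 0 ω = 0
  indep_increments : HasIndepIncrements (fun t : Set.Icc (0 : ℝ) T => W t) P
  law_increments : ∀ s t : ℝ, 0 ≤ s → s ≤ t → t ≤ T →
    HasLaw (fun ω => W t ω - W s ω) (gaussianReal 0 (t - s).toNNReal) P
  continuous_paths : ∀ᵐ ω ∂P, ContinuousOn (fun t => W t ω) (Set.Icc 0 T)

/-- The grid point `t_k = k T / N`. -/
noncomputable def gridPoint (T : ℝ) (N k : ℕ) : ℝ := (k : ℝ) * T / N

/-- The increment of `W` over the grid cell `[t_l, t_{l+1}]`, with cells indexed by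
`l = 0, …, N - 1`; in one-based numbering this is `ΔW_{l+1}`. -/
noncomputable def incr {Ω : Type*} (T : ℝ) (W : ℝ → Ω → ℝ) (N : ℕ) (l : Fin N) (ω : Ω) : ℝ :=
  W (gridPoint T N (l + 1)) ω - W (gridPoint T N l) ω

/-- The σ-algebra `𝒢_k` generated by the first `k` increments. -/
noncomputable abbrev sigmaIncr {Ω : Type*} (T : ℝ) (W : ℝ → Ω → ℝ) (N k : ℕ) : MeasurableSpace Ω :=
  ⨆ (j : Fin N) (_ : (j : ℕ) < k), MeasurableSpace.comap (incr T W N j) inferInstance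

/-- The classical partial derivative `∂_l φ` of a function on `ℝ^N`. -/
noncomputable def partialDeriv {N : ℕ} (l : Fin N) (φ : (Fin N → ℝ) → ℝ) : (Fin N → ℝ) → ℝ :=
  fun x => fderiv ℝ φ x (Pi.single l 1)

/-- `G` is the distributional derivative `∂_l^m F` on `ℝ^N`, where `F` and `G` are locally
integrable. The test functions are smooth and compactly supported, since functions that are square
integrable for a Gaussian measure may grow too fast to be tempered. -/
def IsWeakPartialDeriv {N : ℕ} (l : Fin N) (m : ℕ) (F G : (Fin N → ℝ) → ℝ) : Prop :=
  LocallyIntegrable F ∧ LocallyIntegrable G ∧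
    ∀ φ : (Fin N → ℝ) → ℝ, ContDiff ℝ ((⊤ : ℕ∞) : WithTop ℕ∞) φ → HasCompactSupport φ →
      ∫ x, F x * ((partialDeriv l)^[m] φ) x = (-1) ^ m * ∫ x, G x * φ x

/-- `Y = ∂_l^m X` for functionals `X = F(ΔW_1, …, ΔW_N)` and `Y = G(ΔW_1, …, ΔW_N)` of the
increments, that is, `G = ∂_l^m F` in the distribution sense on `ℝ^N`. -/
def IsFunctionalDeriv {Ω : Type*} [MeasurableSpace Ω] (T : ℝ) (W : ℝ → Ω → ℝ) (P : Measure Ω)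
    {N : ℕ} (l : Fin N) (m : ℕ) (X Y : Ω → ℝ) : Prop :=
  ∃ F G : (Fin N → ℝ) → ℝ, Measurable F ∧ Measurable G ∧
    X =ᵐ[P] (fun ω => F (fun j => incr T W N j ω)) ∧
    Y =ᵐ[P] (fun ω => G (fun j => incr T W N j ω)) ∧
    IsWeakPartialDeriv l m F G

/-- The space `𝔻_{2,n}^{(N)}`: the functionals `X ∈ L²(𝒢_N)` whose distributional derivatives
`∂_l^m X`, for `1 ≤ m ≤ n` and all coordinates `l`, are in `L²`. For fixed `N` the mixed derivatives
of order up to `n` are then in `L²` as well. -/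
def MemD {Ω : Type*} [MeasurableSpace Ω] (T : ℝ) (W : ℝ → Ω → ℝ) (P : Measure Ω)
    (N n : ℕ) (X : Ω → ℝ) : Prop :=
  MemLp X 2 P ∧ AEStronglyMeasurable[sigmaIncr T W N N] X P ∧
    ∀ (l : Fin N) (m : ℕ), 1 ≤ m → m ≤ n →
      ∃ Y : Ω → ℝ, MemLp Y 2 P ∧ IsFunctionalDeriv T W P l m X Y

open Classical in
/-- The derivative `∂_l^m X ∈ L²` of a functional of the increments; it is unique up to almost sure
equality. (Set to `0` if there is no such derivative in `L²`.) -/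
noncomputable def functionalDeriv {Ω : Type*} [MeasurableSpace Ω] (T : ℝ) (W : ℝ → Ω → ℝ)
    (P : Measure Ω) {N : ℕ} (l : Fin N) (m : ℕ) (X : Ω → ℝ) : Ω → ℝ :=
  if h : ∃ Y : Ω → ℝ, MemLp Y 2 P ∧ IsFunctionalDeriv T W P l m X Y then h.choose else 0

/-- The process `D_t^m X`, equal to the derivative of order `m` in the increment over the cell
`[t_l, t_{l+1})` for `t` in that cell. -/
noncomputable def malliavinDeriv {Ω : Type*} [MeasurableSpace Ω] (T : ℝ) (W : ℝ → Ω → ℝ)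
    (P : Measure Ω) (N m : ℕ) (X : Ω → ℝ) (t : ℝ) (ω : Ω) : ℝ :=
  ∑ l : Fin N, (Set.Ico (gridPoint T N l) (gridPoint T N (l + 1))).indicator
    (fun _ => functionalDeriv T W P l m X ω) t

/-- The first-order discrete Clark–Ocone approximation `E[X] + ∑_l E[∂_l X | 𝒢_{l-1}] ΔW_l`
(the conditioning is on the increments strictly before the one in question). -/
noncomputable def clarkOconeApprox {Ω : Type*} [MeasurableSpace Ω] (T : ℝ) (W : ℝ → Ω → ℝ)
    (P : Measure Ω) (N : ℕ) (X : Ω → ℝ) (ω : Ω) : ℝ :=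
  (∫ ω', X ω' ∂P) +
    ∑ l : Fin N, (P[functionalDeriv T W P l 1 X | sigmaIncr T W N l]) ω * incr T W N l ω

end DiscreteClarkOcone

/-
Write `γ` for the product Gaussian law of variance `v = T / N` of the increments, `A_l` for the
average over the coordinate `l`, and `E_l` for the conditional expectation given the first `l`
coordinates. The error of the Clark–Ocone approximation of `F` is the sum over `l` of
`E_{l+1} F - E_l F - E_l[∂_l F] x_l`, which is `E_{l+1}` applied to the one-coordinate remainder
`F - A_l F - (A_l ∂_l F) x_l`. As a function of `x_l` the remainder is centred and its derivative
`∂_l F - A_l ∂_l F` is centred as well, so the Gaussian Poincaré inequality applies twice and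
bounds its squared norm by `v² ‖∂_l² F‖²`. The summands are martingale differences, hence
orthogonal, and the squared error is at most `v² ∑_l ‖∂_l² F‖² = v ∫₀ᵀ ‖D_t² X‖² dt`.
-/

namespace DiscreteClarkOcone

open scoped NNReal Topology Convolution

section WeakLineDeriv

/-- `f` agrees almost everywhere with a locally absolutely continuous function on `ℝ` whose
derivative is `g`. This is the one-dimensional notion of weak derivative that the Poincaré
inequality needs. -/
def IsAEPrimitive (f g : ℝ → ℝ) : Prop :=
  LocallyIntegrable g ∧ ∃ c : ℝ, ∀ᵐ t, f t = c + ∫ s in (0 : ℝ)..t, g s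

lemma IsAEPrimitive.intervalIntegrable {f g : ℝ → ℝ} (h : IsAEPrimitive f g) (a b : ℝ) :
    IntervalIntegrable g volume a b :=
  (h.1.integrableOn_isCompact isCompact_uIcc).intervalIntegrable

variable {E : Type*} [NormedAddCommGroup E] [MeasurableSpace E] [BorelSpace E]
  {μ : Measure E} {e : E} {F G φ : E → ℝ}

lemma locallyIntegrable_comp_add_right [μ.IsAddRightInvariant]
    (hF : LocallyIntegrable F μ) (y : E) : LocallyIntegrable (fun x => F (x + y)) μ :=
  (locallyIntegrable_map_homeomorph (Homeomorph.addRight y)).1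
    ((map_add_right_eq_self μ y).symm ▸ hF)

lemma integral_comp_add_mul_eq_convolution [μ.IsAddRightInvariant] (F φ : E → ℝ) (y : E) :
    ∫ x, F (x + y) * φ x ∂μ =
      (F ⋆[ContinuousLinearMap.mul ℝ ℝ, μ] fun z => φ (-z)) y := by
  simpa [convolution_def] using integral_add_right_eq_self (fun t => F t * φ (t - y)) y

variable [NormedSpace ℝ E]

/-- `G` is the distributional derivative of `F` in the direction `e`. -/
def IsWeakLineDeriv (μ : Measure E) (e : E) (F G : E → ℝ) : Prop :=
  LocallyIntegrable F μ ∧ LocallyIntegrable G μ ∧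
    ∀ φ : E → ℝ, ContDiff ℝ ((⊤ : ℕ∞) : WithTop ℕ∞) φ → HasCompactSupport φ →
      ∫ x, F x * fderiv ℝ φ x e ∂μ = -∫ x, G x * φ x ∂μ

lemma integrable_comp_line [SecondCountableTopology E] [SFinite μ] [μ.IsAddRightInvariant]
    (hG : LocallyIntegrable G μ) (e : E) (a b : ℝ) {K : Set E} (hK : IsCompact K) :
    Integrable (fun p : ℝ × E => G (p.2 + p.1 • e))
      ((volume.restrict (Set.uIoc a b)).prod (μ.restrict K)) := by
  let shear : ℝ × E → ℝ × E := fun p => (p.1, p.2 + p.1 • e)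
  have hshear : MeasurePreserving shear (volume.prod μ) (volume.prod μ) :=
    (MeasurePreserving.id volume).skew_product (g := fun s x => x + s • e)
      (by fun_prop) (ae_of_all _ fun s => (measurePreserving_add_right μ (s • e)).map_eq)
  set I := Set.Icc (min a b) (max a b)
  set K' := Prod.snd '' (shear '' (I ×ˢ K))
  have hK' : IsCompact K' := ((isCompact_Icc.prod hK).image (by fun_prop)).image continuous_snd
  have hint : IntegrableOn (fun p : ℝ × E => G p.2) (I ×ˢ K') (volume.prod μ) := by
    rw [IntegrableOn, ← Measure.prod_restrict]
    exact (hG.integrableOn_isCompact hK').comp_snd _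
  have hpre : Set.uIoc a b ×ˢ K ⊆ shear ⁻¹' (I ×ˢ K') := fun p hp =>
    ⟨Set.Ioc_subset_Icc_self hp.1, shear p, ⟨p, ⟨Set.Ioc_subset_Icc_self hp.1, hp.2⟩, rfl⟩, rfl⟩
  rw [Measure.prod_restrict]
  exact ((hshear.restrict_preimage
    (measurableSet_Icc.prod hK'.measurableSet)).integrable_comp_of_integrable hint).mono_measure
      (Measure.restrict_mono hpre le_rfl)

lemma locallyIntegrable_intervalIntegral_comp_line [ProperSpace E] [SFinite μ]
    [μ.IsAddRightInvariant] (hG : LocallyIntegrable G μ) (e : E) (t : ℝ) :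
    LocallyIntegrable (fun x => ∫ s in (0 : ℝ)..t, G (x + s • e)) μ := by
  refine locallyIntegrable_iff.2 fun K hK => ?_
  simp only [intervalIntegral.intervalIntegral_eq_integral_uIoc]
  exact (integrable_comp_line hG e 0 t hK).integral_prod_right.smul
    (if (0 : ℝ) ≤ t then 1 else -1 : ℝ)

lemma intervalIntegral_integral_comp_line_mul_swap [SecondCountableTopology E] [SFinite μ]
    [μ.IsAddRightInvariant]
    (hG : LocallyIntegrable G μ) (e : E) (t : ℝ) (hφ : Continuous φ) (hφc : HasCompactSupport φ) :
    ∫ s in (0 : ℝ)..t, ∫ x, G (x + s • e) * φ x ∂μ =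
      ∫ x, (∫ s in (0 : ℝ)..t, G (x + s • e)) * φ x ∂μ := by
  obtain ⟨C, hC⟩ := hφc.exists_bound_of_continuous hφ
  have hint : Integrable (Function.uncurry fun (s : ℝ) x => G (x + s • e) * φ x)
      ((volume.restrict (Set.uIoc 0 t)).prod μ) := by
    refine IntegrableOn.integrable_of_forall_notMem_eq_zero (s := Set.univ ×ˢ tsupport φ) ?_
      fun p hp => ?_
    · rw [IntegrableOn, ← Measure.prod_restrict, Measure.restrict_univ]
      exact (integrable_comp_line hG e 0 t hφc).mul_bdd
        (hφ.comp continuous_snd).aestronglyMeasurable (ae_of_all _ fun p => hC p.2)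
    · have hp' : p.2 ∉ tsupport φ := fun h => hp ⟨trivial, h⟩
      simp [Function.uncurry, image_eq_zero_of_notMem_tsupport hp']
  rw [intervalIntegral_integral_swap hint]
  simp only [intervalIntegral.integral_mul_const]

lemma continuous_integral_comp_line_mul [μ.IsAddHaarMeasure] (hG : LocallyIntegrable G μ) (e : E)
    (hφ : Continuous φ) (hφc : HasCompactSupport φ) :
    Continuous fun t : ℝ => ∫ x, G (x + t • e) * φ x ∂μ := by
  simp only [integral_comp_add_mul_eq_convolution]
  exact ((hφc.comp_homeomorph (Homeomorph.neg E)).continuous_convolution_right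
    (ContinuousLinearMap.mul ℝ ℝ) hG (hφ.comp continuous_neg)).comp (by fun_prop)

variable [FiniteDimensional ℝ E] [μ.IsAddHaarMeasure]

lemma IsWeakLineDeriv.hasDerivAt_integral_comp_line_mul (h : IsWeakLineDeriv μ e F G)
    (hφ : ContDiff ℝ ((⊤ : ℕ∞) : WithTop ℕ∞) φ) (hφc : HasCompactSupport φ) (t : ℝ) :
    HasDerivAt (fun t : ℝ => ∫ x, F (x + t • e) * φ x ∂μ) (∫ x, G (x + t • e) * φ x ∂μ) t := by
  have hφn : ContDiff ℝ 1 fun z => φ (-z) := (hφ.of_le (by simp)).comp contDiff_neg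
  have hφnc : HasCompactSupport fun z => φ (-z) := hφc.comp_homeomorph (Homeomorph.neg E)
  have hfderiv (z : E) : fderiv ℝ (fun z => φ (-z)) z e = -fderiv ℝ φ (-z) e := by
    have := (ContinuousLinearEquiv.neg ℝ (M := E)).comp_right_fderiv (f := φ) (x := z)
    simpa [Function.comp_def] using DFunLike.congr_fun this e
  have hconv := (hφnc.hasFDerivAt_convolution_right (ContinuousLinearMap.mul ℝ ℝ) h.1 hφn
    (t • e)).comp_hasDerivAt t ((hasDerivAt_id t).smul_const e)
  rw [one_smul, convolution_precompR_apply _ h.1 (hφnc.fderiv ℝ)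
    (hφn.continuous_fderiv one_ne_zero)] at hconv
  simp only [integral_comp_add_mul_eq_convolution]
  refine hconv.congr_deriv ?_
  have htest := h.2.2 (fun x => φ (x - t • e)) (by fun_prop)
    (hφc.comp_homeomorph (Homeomorph.subRight (t • e)))
  have hfderiv_sub (x : E) : fderiv ℝ (fun x => φ (x - t • e)) x = fderiv ℝ φ (x - t • e) :=
    fderiv_comp_sub (t • e)
  simp only [hfderiv_sub] at htest
  simp only [convolution_def, ContinuousLinearMap.mul_apply', hfderiv, neg_sub, mul_neg,
    integral_neg, htest, neg_neg]

lemma IsWeakLineDeriv.ae_eq_add_intervalIntegral (h : IsWeakLineDeriv μ e F G) (t : ℝ) :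
    ∀ᵐ x ∂μ, F (x + t • e) = F x + ∫ s in (0 : ℝ)..t, G (x + s • e) := by
  have hintegral := locallyIntegrable_intervalIntegral_comp_line h.2.1 e t
  refine ae_eq_of_integral_contDiff_smul_eq
    (locallyIntegrable_comp_add_right h.1 (t • e)) (h.1.add hintegral) fun φ hφ hφc => ?_
  have hftc := intervalIntegral.integral_eq_sub_of_hasDerivAt
    (fun s _ => h.hasDerivAt_integral_comp_line_mul hφ hφc s)
    ((continuous_integral_comp_line_mul h.2.1 e hφ.continuous hφc).intervalIntegrable 0 t)
  rw [intervalIntegral_integral_comp_line_mul_swap h.2.1 e t hφ.continuous hφc] at hftc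
  simp only [zero_smul, add_zero] at hftc
  have hsum := integral_add
    (h.1.integrable_smul_left_of_hasCompactSupport hφ.continuous hφc)
    (hintegral.integrable_smul_left_of_hasCompactSupport hφ.continuous hφc)
  simp only [smul_eq_mul, ← mul_add] at hsum
  simp only [smul_eq_mul, hsum]
  simp only [mul_comm (φ _), hftc]
  ring

lemma measurable_intervalIntegral_comp_line (hG : Measurable G) (e : E) :
    Measurable fun p : E × ℝ => ∫ s in (0 : ℝ)..p.2, G (p.1 + s • e) := by
  have hscale (p : E × ℝ) : ∫ s in (0 : ℝ)..p.2, G (p.1 + s • e) =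
      p.2 * ∫ u in (0 : ℝ)..1, G (p.1 + (p.2 * u) • e) := by
    simpa using (intervalIntegral.smul_integral_comp_mul_left
      (a := 0) (b := 1) (fun s => G (p.1 + s • e)) p.2).symm
  simp only [hscale, intervalIntegral.integral_of_le zero_le_one]
  have hline : Measurable fun q : (E × ℝ) × ℝ => G (q.1.1 + (q.1.2 * q.2) • e) :=
    hG.comp (by fun_prop)
  exact measurable_snd.mul hline.stronglyMeasurable.integral_prod_right'.measurable

lemma ae_locallyIntegrable_comp_line (hG : LocallyIntegrable G μ) (e : E) :
    ∀ᵐ x ∂μ, LocallyIntegrable fun s : ℝ => G (x + s • e) := by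
  have hball (n : ℕ) : ∀ᵐ x ∂μ, x ∈ Metric.closedBall 0 n →
      IntegrableOn (fun s : ℝ => G (x + s • e)) (Set.uIoc (-n) n) :=
    (ae_restrict_iff' measurableSet_closedBall).1
      (integrable_comp_line hG e _ _ (isCompact_closedBall 0 n)).prod_left_ae
  filter_upwards [ae_all_iff.2 hball] with x hx s
  obtain ⟨n, hn⟩ := exists_nat_gt (max ‖x‖ |s|)
  obtain ⟨hxn, hsn⟩ := max_lt_iff.1 hn
  refine ⟨Set.uIoc (-n) n, ?_, hx n (by simpa using hxn.le)⟩
  rw [Set.uIoc_of_le (by simp)]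
  exact Ioc_mem_nhds (abs_lt.1 hsn).1 (abs_lt.1 hsn).2

theorem IsWeakLineDeriv.ae_isAEPrimitive (hF : Measurable F) (hG : Measurable G)
    (h : IsWeakLineDeriv μ e F G) :
    ∀ᵐ x ∂μ, IsAEPrimitive (fun t => F (x + t • e)) (fun t => G (x + t • e)) := by
  have hset : MeasurableSet {p : E × ℝ |
      F (p.1 + p.2 • e) = F p.1 + ∫ s in (0 : ℝ)..p.2, G (p.1 + s • e)} :=
    measurableSet_eq_fun (hF.comp (by fun_prop))
      ((hF.comp measurable_fst).add (measurable_intervalIntegral_comp_line hG e))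
  filter_upwards [ae_locallyIntegrable_comp_line h.2.1 e,
    (Measure.ae_ae_comm hset).2
      (ae_of_all volume h.ae_eq_add_intervalIntegral)] with x hint hx
  exact ⟨hint, F x, hx⟩

end WeakLineDeriv

section GaussianPoincare

lemma integral_sub_mul_sub_prod_self {α : Type*} [MeasurableSpace α] {ν : Measure α}
    [IsProbabilityMeasure ν] {f g : α → ℝ} (hf : MemLp f 2 ν) (hg : MemLp g 2 ν) :
    ∫ p, (f p.2 - f p.1) * (g p.2 - g p.1) ∂(ν.prod ν) = 2 * cov[f, g; ν] := by
  have hfg : Integrable (fun x => f x * g x) ν := hf.integrable_mul hg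
  have hf₁ := hf.integrable one_le_two
  have hg₁ := hg.integrable one_le_two
  have hdiag : Integrable (fun p : α × α => f p.2 * g p.2 + f p.1 * g p.1) (ν.prod ν) :=
    (hfg.comp_snd ν).add (hfg.comp_fst ν)
  have hcross : Integrable (fun p : α × α => f p.1 * g p.2 + g p.1 * f p.2) (ν.prod ν) :=
    (hf₁.mul_prod hg₁).add (hg₁.mul_prod hf₁)
  calc ∫ p, (f p.2 - f p.1) * (g p.2 - g p.1) ∂(ν.prod ν)
      = ∫ p, (f p.2 * g p.2 + f p.1 * g p.1) - (f p.1 * g p.2 + g p.1 * f p.2) ∂(ν.prod ν) :=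
        integral_congr_ae (ae_of_all _ fun p => by ring)
    _ = (∫ x, f x * g x ∂ν + ∫ x, f x * g x ∂ν)
          - ((∫ x, f x ∂ν) * ∫ x, g x ∂ν + (∫ x, g x ∂ν) * ∫ x, f x ∂ν) := by
        rw [integral_sub hdiag hcross, integral_add (hfg.comp_snd ν) (hfg.comp_fst ν),
          integral_add (hf₁.mul_prod hg₁) (hg₁.mul_prod hf₁), integral_prod_mul,
          integral_prod_mul, integral_fun_snd (fun x => f x * g x),
          integral_fun_fst (fun x => f x * g x)]
        simp
    _ = 2 * cov[f, g; ν] := by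
        rw [covariance_eq_sub hf hg]
        simp only [Pi.mul_apply]
        ring

lemma two_mul_evariance_eq_lintegral_prod {α : Type*} [MeasurableSpace α] {ν : Measure α}
    [IsProbabilityMeasure ν] {f : α → ℝ} (hf : MemLp f 2 ν) :
    2 * evariance f ν = ∫⁻ p, ‖f p.2 - f p.1‖ₑ ^ 2 ∂(ν.prod ν) := by
  have hdiff : MemLp (fun p : α × α => f p.2 - f p.1) 2 (ν.prod ν) :=
    (hf.comp_snd ν).sub (hf.comp_fst ν)
  have hsq : Integrable (fun p : α × α => (f p.2 - f p.1) * (f p.2 - f p.1)) (ν.prod ν) :=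
    hdiff.integrable_mul hdiff
  have henorm (p : α × α) : ‖f p.2 - f p.1‖ₑ ^ 2 =
      ENNReal.ofReal ((f p.2 - f p.1) * (f p.2 - f p.1)) := by
    rw [← sq, ← enorm_pow, Real.enorm_of_nonneg (sq_nonneg _)]
  simp only [henorm]
  rw [← ofReal_integral_eq_lintegral_ofReal hsq
    (ae_of_all _ fun p => mul_self_nonneg _), integral_sub_mul_sub_prod_self hf hf,
    covariance_self hf.aemeasurable, ENNReal.ofReal_mul zero_le_two, ofReal_variance hf]
  simp

lemma enorm_integral_sq_le {α : Type*} [MeasurableSpace α] {μ : Measure α} {f : α → ℝ}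
    (hf : AEMeasurable f μ) :
    ‖∫ x, f x ∂μ‖ₑ ^ 2 ≤ μ Set.univ * ∫⁻ x, ‖f x‖ₑ ^ 2 ∂μ := by
  have hHolder := ENNReal.lintegral_mul_le_Lp_mul_Lq μ Real.HolderConjugate.two_two
    (f := fun _ => 1) (g := fun x => ‖f x‖ₑ) aemeasurable_const hf.enorm
  simp only [Pi.mul_apply, one_mul, lintegral_const, ENNReal.rpow_two, one_pow] at hHolder
  calc ‖∫ x, f x ∂μ‖ₑ ^ 2
      ≤ (μ Set.univ ^ (1 / 2 : ℝ) * (∫⁻ x, ‖f x‖ₑ ^ 2 ∂μ) ^ (1 / 2 : ℝ)) ^ 2 := by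
        gcongr
        exact (enorm_integral_le_lintegral_enorm f).trans hHolder
    _ = μ Set.univ * ∫⁻ x, ‖f x‖ₑ ^ 2 ∂μ := by
        rw [mul_pow, ← ENNReal.rpow_natCast, ← ENNReal.rpow_natCast, ← ENNReal.rpow_mul,
          ← ENNReal.rpow_mul]
        norm_num

lemma ofReal_sub_mul_indicator_Ici_sub (a b t : ℝ) :
    ENNReal.ofReal ((b - a) * ((Set.Ici t).indicator 1 b - (Set.Ici t).indicator 1 a)) =
      (Set.uIoc a b).indicator (fun _ => ‖b - a‖ₑ) t := by
  rcases le_total a b with hab | hab <;> by_cases ha : t ≤ a <;> by_cases hb : t ≤ b <;>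
    simp [Set.indicator, ha, hb, Real.enorm_eq_ofReal_abs, abs_of_nonneg, abs_of_nonpos, hab]

lemma enorm_intervalIntegral_sq_le {g : ℝ → ℝ} (hg : Measurable g) (a b : ℝ) :
    ‖∫ t in a..b, g t‖ₑ ^ 2 ≤ ∫⁻ t, ENNReal.ofReal
      ((b - a) * ((Set.Ici t).indicator 1 b - (Set.Ici t).indicator 1 a)) * ‖g t‖ₑ ^ 2 := by
  simp only [ofReal_sub_mul_indicator_Ici_sub]
  have hprod (t : ℝ) : (Set.uIoc a b).indicator (fun _ => ‖b - a‖ₑ) t * ‖g t‖ₑ ^ 2 =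
      (Set.uIoc a b).indicator (fun t => ‖b - a‖ₑ * ‖g t‖ₑ ^ 2) t :=
    (Set.indicator_mul_left _ _ fun t => ‖g t‖ₑ ^ 2).symm
  simp only [hprod]
  rw [lintegral_indicator measurableSet_uIoc, lintegral_const_mul _ (by fun_prop)]
  have hnorm : ‖∫ t in a..b, g t‖ₑ = ‖∫ t in Set.uIoc a b, g t‖ₑ := by
    simp only [← ofReal_norm, intervalIntegral.norm_intervalIntegral_eq]
  simpa [hnorm, Real.volume_uIoc, Real.enorm_eq_ofReal_abs] using
    enorm_integral_sq_le (μ := volume.restrict (Set.uIoc a b)) hg.aemeasurable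

lemma IsAEPrimitive.ae_sub_eq_intervalIntegral {f g : ℝ → ℝ} (h : IsAEPrimitive f g)
    {ν : Measure ℝ} [SFinite ν] (hν : ν ≪ volume) :
    ∀ᵐ p ∂(ν.prod ν), f p.2 - f p.1 = ∫ t in p.1..p.2, g t := by
  obtain ⟨-, c, hc⟩ := id h
  filter_upwards [Measure.quasiMeasurePreserving_fst.ae (hν.ae_le hc),
    Measure.quasiMeasurePreserving_snd.ae (hν.ae_le hc)] with p h₁ h₂
  linear_combination h₂ - h₁ +
    intervalIntegral.integral_interval_sub_left (h.intervalIntegrable 0 p.2)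
      (h.intervalIntegrable 0 p.1)

variable {m : ℝ} {v : ℝ≥0}

lemma hasDerivAt_gaussianPDFReal (hv : v ≠ 0) (x : ℝ) :
    HasDerivAt (fun x => -(v * gaussianPDFReal m v x)) (gaussianPDFReal m v x * (x - m)) x := by
  have hv' : (v : ℝ) ≠ 0 := by exact_mod_cast hv
  have hexponent : HasDerivAt (fun x : ℝ => -(x - m) ^ 2 / (2 * v)) (-(x - m) / v) x := by
    refine (((((hasDerivAt_id x).sub_const m).pow 2).neg).div_const (2 * (v : ℝ))).congr_deriv ?_
    simp
    field_simp
    ring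
  refine ((hexponent.exp.const_mul (√(2 * Real.pi * v))⁻¹).const_mul (v : ℝ)).neg.congr_deriv ?_
  simp only [gaussianPDFReal]
  field_simp

lemma tendsto_gaussianPDFReal_atTop (hv : v ≠ 0) :
    Tendsto (gaussianPDFReal m v) atTop (𝓝 0) := by
  have hv' : (0 : ℝ) < v := by exact_mod_cast pos_iff_ne_zero.2 hv
  have hexponent : Tendsto (fun x : ℝ => -(x - m) ^ 2 / (2 * v)) atTop atBot := by
    simp only [neg_div]
    exact tendsto_neg_atTop_atBot.comp (((tendsto_pow_atTop two_ne_zero).comp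
      (tendsto_atTop_add_const_right _ _ tendsto_id)).atTop_div_const (mul_pos two_pos hv'))
  simpa [gaussianPDFReal_def, Function.comp_def] using
    (Real.tendsto_exp_atBot.comp hexponent).const_mul (√(2 * Real.pi * v))⁻¹

lemma covariance_id_indicator_Ici_gaussianReal (hv : v ≠ 0) (t : ℝ) :
    cov[fun x => x, (Set.Ici t).indicator 1; gaussianReal m v] = v * gaussianPDFReal m v t := by
  have hid : MemLp (fun x : ℝ => x) 2 (gaussianReal m v) := memLp_id_gaussianReal' 2 (by simp)
  have hind : MemLp ((Set.Ici t).indicator (1 : ℝ → ℝ)) 2 (gaussianReal m v) :=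
    (memLp_const 1).indicator measurableSet_Ici
  have hcentered : Integrable (fun x => gaussianPDFReal m v x * (x - m)) := by
    have h := (hid.integrable one_le_two).sub (integrable_const m)
    rw [gaussianReal_of_var_ne_zero _ hv, integrable_withDensity_iff
      (measurable_gaussianPDF _ _) (ae_of_all _ fun _ => gaussianPDF_lt_top)] at h
    simpa [toReal_gaussianPDF, mul_comm] using h
  have htail : ∫ x in Set.Ioi t, gaussianPDFReal m v x * (x - m) = v * gaussianPDFReal m v t := by
    rw [integral_Ioi_of_hasDerivAt_of_tendsto' (m := 0)
      (fun x _ => hasDerivAt_gaussianPDFReal hv x) hcentered.integrableOn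
      (by simpa using ((tendsto_gaussianPDFReal_atTop hv).const_mul (v : ℝ)).neg)]
    ring
  have hweight (x : ℝ) : gaussianPDFReal m v x • ((x - m) * (Set.Ici t).indicator 1 x) =
      (Set.Ici t).indicator (fun x => gaussianPDFReal m v x * (x - m)) x := by
    by_cases hx : x ∈ Set.Ici t <;> simp [hx]
  have hmean : ∫ x, x - m ∂(gaussianReal m v) = 0 := by
    rw [integral_sub (hid.integrable one_le_two) (integrable_const m), integral_id_gaussianReal]
    simp
  calc cov[fun x => x, (Set.Ici t).indicator 1; gaussianReal m v]
      = cov[fun x => x - m, (Set.Ici t).indicator 1; gaussianReal m v] :=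
        (covariance_sub_const_left (hid.integrable one_le_two) m).symm
    _ = ∫ x, (x - m) * (Set.Ici t).indicator 1 x ∂(gaussianReal m v) := by
        rw [covariance_eq_sub (X := fun x => x - m) (hid.sub (memLp_const m)) hind, hmean,
          zero_mul, sub_zero]
        rfl
    _ = v * gaussianPDFReal m v t := by
        rw [integral_gaussianReal_eq_integral_smul hv]
        simp only [hweight]
        rw [integral_indicator measurableSet_Ici, integral_Ici_eq_integral_Ioi, htail]

lemma lintegral_ofReal_sub_mul_indicator_Ici_gaussianReal (hv : v ≠ 0) (t : ℝ) :
    ∫⁻ p, ENNReal.ofReal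
        ((p.2 - p.1) * ((Set.Ici t).indicator 1 p.2 - (Set.Ici t).indicator 1 p.1))
      ∂((gaussianReal m v).prod (gaussianReal m v)) = 2 * v * gaussianPDF m v t := by
  have hid : MemLp (fun x : ℝ => x) 2 (gaussianReal m v) := memLp_id_gaussianReal' 2 (by simp)
  have hind : MemLp ((Set.Ici t).indicator (1 : ℝ → ℝ)) 2 (gaussianReal m v) :=
    (memLp_const 1).indicator measurableSet_Ici
  have hint : Integrable (fun p : ℝ × ℝ =>
      (p.2 - p.1) * ((Set.Ici t).indicator 1 p.2 - (Set.Ici t).indicator 1 p.1))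
      ((gaussianReal m v).prod (gaussianReal m v)) :=
    ((hid.comp_snd _).sub (hid.comp_fst _)).integrable_mul
      ((hind.comp_snd _).sub (hind.comp_fst _))
  have hnonneg (p : ℝ × ℝ) :
      0 ≤ (p.2 - p.1) * ((Set.Ici t).indicator 1 p.2 - (Set.Ici t).indicator 1 p.1) := by
    by_cases h₁ : t ≤ p.1 <;> by_cases h₂ : t ≤ p.2 <;> simp [Set.indicator, h₁, h₂] <;> grind
  rw [← ofReal_integral_eq_lintegral_ofReal hint (ae_of_all _ hnonneg),
    integral_sub_mul_sub_prod_self hid hind, covariance_id_indicator_Ici_gaussianReal hv,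
    ENNReal.ofReal_mul zero_le_two, ENNReal.ofReal_mul v.coe_nonneg, mul_assoc]
  simp [gaussianPDF]

/-- By Cauchy–Schwarz on the segment between two independent samples `x` and `y`, `2 Var f` is at
most the integral over `t` of `g t ^ 2` times the mean of `(y - x) (1_{t ≤ y} - 1_{t ≤ x})`. This
mean is twice the covariance of the identity and `1_{t ≤ ·}`, which is `v` times the density at
`t`. -/
theorem evariance_gaussianReal_le (hv : v ≠ 0) {f g : ℝ → ℝ} (hf : MemLp f 2 (gaussianReal m v))
    (hg : Measurable g) (h : IsAEPrimitive f g) :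
    evariance f (gaussianReal m v) ≤ v * ∫⁻ t, ‖g t‖ₑ ^ 2 ∂(gaussianReal m v) := by
  set γ := gaussianReal m v with hγ
  set k : ℝ × ℝ → ℝ → ℝ≥0∞ := fun p t => ENNReal.ofReal
    ((p.2 - p.1) * ((Set.Ici t).indicator 1 p.2 - (Set.Ici t).indicator 1 p.1))
  have hind (π : ℝ × ℝ → ℝ) (hπ : Measurable π) :
      Measurable fun q : (ℝ × ℝ) × ℝ => (Set.Ici q.2).indicator (1 : ℝ → ℝ) (π q.1) :=
    Measurable.ite (measurableSet_le measurable_snd (hπ.comp measurable_fst))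
      measurable_const measurable_const
  have hk_meas : Measurable (Function.uncurry k) := by
    have hsub : Measurable fun q : (ℝ × ℝ) × ℝ => q.1.2 - q.1.1 := by fun_prop
    exact (hsub.mul
      ((hind Prod.snd measurable_snd).sub (hind Prod.fst measurable_fst))).ennreal_ofReal
  have hpoincare : 2 * evariance f γ ≤ 2 * (v * ∫⁻ t, ‖g t‖ₑ ^ 2 ∂γ) := by
    calc 2 * evariance f γ
        = ∫⁻ p, ‖f p.2 - f p.1‖ₑ ^ 2 ∂(γ.prod γ) := two_mul_evariance_eq_lintegral_prod hf
      _ ≤ ∫⁻ p, (∫⁻ t, k p t * ‖g t‖ₑ ^ 2) ∂(γ.prod γ) := by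
          refine lintegral_mono_ae ?_
          filter_upwards [h.ae_sub_eq_intervalIntegral (gaussianReal_absolutelyContinuous m hv)]
            with p hp
          exact hp ▸ enorm_intervalIntegral_sq_le hg p.1 p.2
      _ = ∫⁻ t, ∫⁻ p, k p t * ‖g t‖ₑ ^ 2 ∂(γ.prod γ) :=
          lintegral_lintegral_swap (hk_meas.mul
            (g := fun q : (ℝ × ℝ) × ℝ => ‖g q.2‖ₑ ^ 2) (by fun_prop)).aemeasurable
      _ = ∫⁻ t, 2 * v * (gaussianPDF m v t * ‖g t‖ₑ ^ 2) := by
          refine lintegral_congr fun t => ?_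
          rw [lintegral_mul_const _ (hk_meas.of_uncurry_right (y := t)),
            lintegral_ofReal_sub_mul_indicator_Ici_gaussianReal hv, mul_assoc]
      _ = 2 * (v * ∫⁻ t, ‖g t‖ₑ ^ 2 ∂γ) := by
          rw [hγ, gaussianReal_of_var_ne_zero _ hv,
            lintegral_withDensity_eq_lintegral_mul _ (measurable_gaussianPDF _ _) (by fun_prop),
            lintegral_const_mul _ (by have := measurable_gaussianPDF m v; fun_prop), mul_assoc]
          rfl
  exact (ENNReal.mul_le_mul_iff_right two_ne_zero ENNReal.ofNat_ne_top).1 hpoincare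

end GaussianPoincare

section ProductMeasure

lemma integral_comp_of_measurePreserving {α β : Type*} [MeasurableSpace α] [MeasurableSpace β]
    {μ : Measure α} {ν : Measure β} {V : α → β} (hV : MeasurePreserving V μ ν) {f : β → ℝ}
    (hf : AEStronglyMeasurable f ν) : ∫ x, f (V x) ∂μ = ∫ y, f y ∂ν := by
  rw [← hV.map_eq, integral_map hV.aemeasurable (by rwa [hV.map_eq])]

lemma compl_singleton_piecewise_eq_update {ι : Type*} {X : ι → Type*} [DecidableEq ι] {i : ι}
    [∀ j, Decidable (j ∈ ({i}ᶜ : Set ι))] (x y : ∀ j, X j) :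
    ({i}ᶜ : Set ι).piecewise x y = Function.update x i (y i) := by
  ext j
  by_cases hj : j = i
  · subst hj; simp
  · simp [hj]

variable {ι : Type*} {X : ι → Type*} [∀ i, MeasurableSpace (X i)] {s t : Set ι}

open scoped Classical in
lemma measurable_piecewise_cylinderEvents :
    Measurable[(cylinderEvents s).prod MeasurableSpace.pi]
      fun p : (∀ i, X i) × (∀ i, X i) => s.piecewise p.1 p.2 := by
  refine @measurable_pi_lambda _ _ _ ((cylinderEvents s).prod MeasurableSpace.pi) _ _ fun i => ?_
  by_cases hi : i ∈ s
  · simp only [Set.piecewise_eq_of_mem _ _ _ hi]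
    exact (measurable_cylinderEvent_apply hi).comp (@measurable_fst _ _ (cylinderEvents s) _)
  · simp only [Set.piecewise_eq_of_notMem _ _ _ hi]
    exact (measurable_pi_apply i).comp (@measurable_snd _ _ (cylinderEvents s) _)

open scoped Classical in
lemma piecewise_mem_iff_of_measurableSet_cylinderEvents {A : Set (∀ i, X i)}
    (hA : MeasurableSet[cylinderEvents s] A) (x y : ∀ i, X i) :
    s.piecewise x y ∈ A ↔ x ∈ A := by
  have hle : cylinderEvents s ≤ MeasurableSpace.comap (s.domRestrict (π := X)) inferInstance := by
    refine iSup₂_le fun i hi => ?_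
    rintro _ ⟨B, hB, rfl⟩
    exact ⟨(fun z => z ⟨i, hi⟩) ⁻¹' B, measurable_pi_apply _ hB, rfl⟩
  obtain ⟨B, -, rfl⟩ := hle A hA
  have hrestrict : s.domRestrict (s.piecewise x y) = s.domRestrict x :=
    funext fun i => Set.piecewise_eq_of_mem _ _ _ i.2
  simp only [Set.mem_preimage, hrestrict]

variable [Fintype ι] {μ : ∀ i, Measure (X i)} [∀ i, IsProbabilityMeasure (μ i)]
  {f : (∀ i, X i) → ℝ}

open scoped Classical in
lemma measurePreserving_piecewise (s : Set ι) :
    MeasurePreserving (fun p : (∀ i, X i) × (∀ i, X i) => s.piecewise p.1 p.2)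
      ((Measure.pi μ).prod (Measure.pi μ)) (Measure.pi μ) := by
  have hmeas : Measurable fun p : (∀ i, X i) × (∀ i, X i) => s.piecewise p.1 p.2 :=
    measurable_piecewise_cylinderEvents.mono (sup_le_sup_right
      (MeasurableSpace.comap_mono cylinderEvents_le_pi) _) le_rfl
  refine ⟨hmeas, (Measure.pi_eq fun B hB => ?_).symm⟩
  have hpreimage : (fun p : (∀ i, X i) × (∀ i, X i) => s.piecewise p.1 p.2) ⁻¹' Set.univ.pi B =
      (Set.univ.pi fun i => if i ∈ s then B i else Set.univ) ×ˢ
        (Set.univ.pi fun i => if i ∈ s then Set.univ else B i) := by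
    ext p
    simp only [Set.mem_preimage, Set.mem_univ_pi, Set.mem_prod, ← forall_and]
    refine forall_congr' fun i => ?_
    by_cases hi : i ∈ s <;> simp [hi]
  rw [Measure.map_apply hmeas (MeasurableSet.univ_pi hB), hpreimage, Measure.prod_prod,
    Measure.pi_pi, Measure.pi_pi, ← Finset.prod_mul_distrib]
  refine Finset.prod_congr rfl fun i _ => ?_
  by_cases hi : i ∈ s <;> simp [hi]

open scoped Classical in
/-- The average of `f` over the coordinates outside `s`: the version of the conditional
expectation of `f` given the coordinates in `s` provided by Fubini's theorem. -/
noncomputable def partialAvg (μ : ∀ i, Measure (X i)) (s : Set ι) (f : (∀ i, X i) → ℝ)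
    (x : ∀ i, X i) : ℝ :=
  ∫ y, f (s.piecewise x y) ∂(Measure.pi μ)

lemma stronglyMeasurable_partialAvg (hf : StronglyMeasurable f) :
    StronglyMeasurable[cylinderEvents s] (partialAvg μ s f) := by
  classical
  exact @StronglyMeasurable.integral_prod_right' _ _ _ (cylinderEvents s) _ _ _ _ _ _
    (hf.comp_measurable measurable_piecewise_cylinderEvents)

lemma setIntegral_partialAvg (hf : Integrable f (Measure.pi μ)) {A : Set (∀ i, X i)}
    (hA : MeasurableSet[cylinderEvents s] A) :
    ∫ x in A, partialAvg μ s f x ∂(Measure.pi μ) = ∫ x in A, f x ∂(Measure.pi μ) := by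
  classical
  have hA' : MeasurableSet A := cylinderEvents_le_pi A hA
  have hpw := measurePreserving_piecewise (μ := μ) s
  have hint : Integrable (A.indicator f) (Measure.pi μ) := hf.indicator hA'
  calc ∫ x in A, partialAvg μ s f x ∂(Measure.pi μ)
      = ∫ x, ∫ y, A.indicator f (s.piecewise x y) ∂(Measure.pi μ) ∂(Measure.pi μ) := by
        rw [← integral_indicator hA']
        refine integral_congr_ae (ae_of_all _ fun x => ?_)
        by_cases hx : x ∈ A <;>
          simp [hx, Set.indicator, partialAvg, piecewise_mem_iff_of_measurableSet_cylinderEvents hA]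
    _ = ∫ p, A.indicator f (s.piecewise p.1 p.2) ∂((Measure.pi μ).prod (Measure.pi μ)) :=
        integral_integral (hpw.integrable_comp_of_integrable hint)
    _ = ∫ x in A, f x ∂(Measure.pi μ) := by
        rw [integral_comp_of_measurePreserving hpw hint.aestronglyMeasurable,
          integral_indicator hA']

lemma integrable_partialAvg (hf : Integrable f (Measure.pi μ)) :
    Integrable (partialAvg μ s f) (Measure.pi μ) := by
  classical
  exact ((measurePreserving_piecewise s).integrable_comp_of_integrable hf).integral_prod_left

theorem condExp_cylinderEvents_ae_eq_partialAvg (hf : StronglyMeasurable f)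
    (hfi : Integrable f (Measure.pi μ)) :
    (Measure.pi μ)[f | cylinderEvents s] =ᵐ[Measure.pi μ] partialAvg μ s f :=
  (ae_eq_condExp_of_forall_setIntegral_eq cylinderEvents_le_pi hfi
    (fun _ _ _ => (integrable_partialAvg hfi).integrableOn)
    (fun _ hA _ => setIntegral_partialAvg hfi hA)
    (stronglyMeasurable_partialAvg hf).aestronglyMeasurable).symm

lemma partialAvg_partialAvg_ae_eq (hf : Integrable f (Measure.pi μ)) :
    partialAvg μ s (partialAvg μ t f) =ᵐ[Measure.pi μ] partialAvg μ (s ∩ t) f := by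
  classical
  obtain ⟨u, hu⟩ : ∃ u, u = s ∩ t := ⟨_, rfl⟩
  have hpw (s : Set ι) := measurePreserving_piecewise (μ := μ) s
  have hregroup (x y z : ∀ i, X i) :
      t.piecewise (s.piecewise x y) z = u.piecewise x (t.piecewise y z) := by
    ext i
    by_cases hs : i ∈ s <;> by_cases ht : i ∈ t <;> simp [Set.piecewise, hu, hs, ht]
  rw [← hu]
  filter_upwards [((hpw u).integrable_comp_of_integrable hf).prod_right_ae] with x hx
  calc partialAvg μ s (partialAvg μ t f) x
      = ∫ y, ∫ z, f (u.piecewise x (t.piecewise y z)) ∂(Measure.pi μ) ∂(Measure.pi μ) := by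
        simp only [partialAvg, hregroup]
    _ = ∫ p, f (u.piecewise x (t.piecewise p.1 p.2))
          ∂((Measure.pi μ).prod (Measure.pi μ)) :=
        integral_integral (f := fun y z => f (u.piecewise x (t.piecewise y z)))
          ((hpw t).integrable_comp_of_integrable hx)
    _ = partialAvg μ u f x :=
        integral_comp_of_measurePreserving (hpw t) hx.aestronglyMeasurable

theorem condExp_cylinderEvents_condExp_cylinderEvents (hf : StronglyMeasurable f)
    (hfi : Integrable f (Measure.pi μ)) :
    (Measure.pi μ)[(Measure.pi μ)[f | cylinderEvents t] | cylinderEvents s]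
      =ᵐ[Measure.pi μ] (Measure.pi μ)[f | cylinderEvents (s ∩ t)] :=
  calc (Measure.pi μ)[(Measure.pi μ)[f | cylinderEvents t] | cylinderEvents s]
      =ᵐ[Measure.pi μ] (Measure.pi μ)[partialAvg μ t f | cylinderEvents s] :=
        condExp_congr_ae (condExp_cylinderEvents_ae_eq_partialAvg hf hfi)
    _ =ᵐ[Measure.pi μ] partialAvg μ s (partialAvg μ t f) :=
        condExp_cylinderEvents_ae_eq_partialAvg
          ((stronglyMeasurable_partialAvg hf).mono cylinderEvents_le_pi)
          (integrable_partialAvg hfi)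
    _ =ᵐ[Measure.pi μ] partialAvg μ (s ∩ t) f := partialAvg_partialAvg_ae_eq hfi
    _ =ᵐ[Measure.pi μ] (Measure.pi μ)[f | cylinderEvents (s ∩ t)] :=
        (condExp_cylinderEvents_ae_eq_partialAvg hf hfi).symm

variable [DecidableEq ι]

lemma measurePreserving_update (i : ι) :
    MeasurePreserving (fun p : (∀ j, X j) × X i => Function.update p.1 i p.2)
      ((Measure.pi μ).prod (μ i)) (Measure.pi μ) := by
  classical
  have heval := (MeasurePreserving.id (Measure.pi μ)).prod (measurePreserving_eval μ i)
  rw [← heval.map_eq]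
  have hpw := measurePreserving_piecewise (μ := μ) ({i}ᶜ : Set ι)
  simp only [compl_singleton_piecewise_eq_update] at hpw
  exact MeasurePreserving.map_of_comp hpw measurable_update' heval.measurable

lemma partialAvg_compl_singleton {i : ι} (hf : StronglyMeasurable f) (x : ∀ j, X j) :
    partialAvg μ {i}ᶜ f x = ∫ a, f (Function.update x i a) ∂(μ i) := by
  simp only [partialAvg, compl_singleton_piecewise_eq_update]
  exact integral_comp_of_measurePreserving (measurePreserving_eval μ i)
    (hf.comp_measurable (measurable_update x)).aestronglyMeasurable

end ProductMeasure

section SquareIntegrable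

variable {α β : Type*} {m mα : MeasurableSpace α} {m' mβ : MeasurableSpace β} {μ : Measure α}
  {ν : Measure β}

lemma eLpNorm_two_sq (f : α → ℝ) (μ : Measure α) :
    eLpNorm f 2 μ ^ 2 = ∫⁻ x, ‖f x‖ₑ ^ 2 ∂μ := by
  simpa using eLpNorm_nnreal_pow_eq_lintegral (f := f) (μ := μ) (p := 2) two_ne_zero

lemma eLpNorm_two_sq_eq_ofReal_integral_sq {f : α → ℝ} (hf : MemLp f 2 μ) :
    eLpNorm f 2 μ ^ 2 = ENNReal.ofReal (∫ x, f x ^ 2 ∂μ) := by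
  rw [eLpNorm_two_sq, ofReal_integral_eq_lintegral_ofReal hf.integrable_sq
    (ae_of_all _ fun x => sq_nonneg _)]
  simp only [← enorm_pow, Real.enorm_of_nonneg (sq_nonneg _)]

lemma condExp_comp_of_measurePreserving [IsProbabilityMeasure μ] [IsProbabilityMeasure ν]
    {V : α → β} (hV : MeasurePreserving V μ ν) (hm : m' ≤ mβ) {f : β → ℝ} (hf : Integrable f ν) :
    μ[f ∘ V | m'.comap V] =ᵐ[μ] ν[f | m'] ∘ V := by
  have hle : m'.comap V ≤ mα := (MeasurableSpace.comap_mono hm).trans hV.measurable.comap_le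
  refine (ae_eq_condExp_of_forall_setIntegral_eq hle (hV.integrable_comp_of_integrable hf)
    (fun _ _ _ => (hV.integrable_comp_of_integrable integrable_condExp).integrableOn) ?_
    (stronglyMeasurable_condExp.comp_measurable (comap_measurable V)).aestronglyMeasurable).symm
  rintro _ ⟨A, hA, rfl⟩ -
  have hset (k : β → ℝ) (hk : Integrable k ν) :
      ∫ x in V ⁻¹' A, k (V x) ∂μ = ∫ y in A, k y ∂ν :=
    integral_comp_of_measurePreserving (hV.restrict_preimage (hm A hA))
      hk.aestronglyMeasurable.restrict
  simp only [Function.comp_apply]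
  rw [hset _ integrable_condExp, hset _ hf, setIntegral_condExp hm hf hA]

lemma integral_mul_eq_zero_of_condExp_eq_zero [IsFiniteMeasure μ]
    (hm : m ≤ mα) {f g : α → ℝ} (hf : MemLp f 2 μ) (hfm : AEStronglyMeasurable[m] f μ)
    (hg : MemLp g 2 μ) (hgm : μ[g | m] =ᵐ[μ] 0) : ∫ x, f x * g x ∂μ = 0 := by
  have hpull : μ[f * g | m] =ᵐ[μ] f * μ[g | m] :=
    condExp_mul_of_aestronglyMeasurable_left hfm (hf.integrable_mul hg)
      (hg.integrable one_le_two)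
  calc ∫ x, f x * g x ∂μ = ∫ x, (μ[f * g | m]) x ∂μ := (integral_condExp hm).symm
    _ = ∫ _, (0 : ℝ) ∂μ := by
        refine integral_congr_ae ?_
        filter_upwards [hpull, hgm] with x h₁ h₂
        simp [h₁, h₂]
    _ = 0 := integral_zero _ _

theorem eLpNorm_sum_sq_of_condExp_eq_zero [IsFiniteMeasure μ] {ι : Type*} [LinearOrder ι]
    {s : Finset ι} {m : ι → MeasurableSpace α} (hm : ∀ i, m i ≤ mα) {d : ι → α → ℝ}
    (hd : ∀ i, MemLp (d i) 2 μ) (hadapted : ∀ i j, i < j → AEStronglyMeasurable[m j] (d i) μ)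
    (hcond : ∀ i, μ[d i | m i] =ᵐ[μ] 0) :
    eLpNorm (∑ i ∈ s, d i) 2 μ ^ 2 = ∑ i ∈ s, eLpNorm (d i) 2 μ ^ 2 := by
  have horth (i j : ι) (hij : i ≠ j) : ∫ x, d i x * d j x ∂μ = 0 := by
    rcases hij.lt_or_gt with h | h
    · exact integral_mul_eq_zero_of_condExp_eq_zero (hm j) (hd i) (hadapted i j h) (hd j) (hcond j)
    · simpa only [mul_comm] using integral_mul_eq_zero_of_condExp_eq_zero (hm i) (hd j)
        (hadapted j i h) (hd i) (hcond i)
  have hint (i j : ι) : Integrable (fun x => d i x * d j x) μ := (hd i).integrable_mul (hd j)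
  have hexpand : ∫ x, (∑ i ∈ s, d i) x ^ 2 ∂μ = ∑ i ∈ s, ∫ x, d i x ^ 2 ∂μ :=
    calc ∫ x, (∑ i ∈ s, d i) x ^ 2 ∂μ = ∫ x, ∑ i ∈ s, ∑ j ∈ s, d i x * d j x ∂μ := by
          simp only [Finset.sum_apply, sq, Finset.sum_mul_sum]
      _ = ∑ i ∈ s, ∑ j ∈ s, ∫ x, d i x * d j x ∂μ := by
          rw [integral_finsetSum _ fun i _ => integrable_finsetSum _ fun j _ => hint i j]
          exact Finset.sum_congr rfl fun i _ => integral_finsetSum _ fun j _ => hint i j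
      _ = ∑ i ∈ s, ∫ x, d i x ^ 2 ∂μ := by
          refine Finset.sum_congr rfl fun i hi => ?_
          rw [Finset.sum_eq_single_of_mem i hi fun j _ hji => horth i j hji.symm]
          simp only [sq]
  rw [eLpNorm_two_sq_eq_ofReal_integral_sq (memLp_finsetSum' s fun i _ => hd i), hexpand,
    ENNReal.ofReal_sum_of_nonneg fun i _ => integral_nonneg fun x => sq_nonneg _]
  exact Finset.sum_congr rfl fun i _ => (eLpNorm_two_sq_eq_ofReal_integral_sq (hd i)).symm

end SquareIntegrable

section CoordinatePoincare

section ProductVariance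

variable {ι : Type*} [Fintype ι] [DecidableEq ι] {X : ι → Type*} [∀ i, MeasurableSpace (X i)]
  {μ : ∀ i, Measure (X i)} [∀ i, IsProbabilityMeasure (μ i)]

lemma lintegral_lintegral_update (i : ι) {f : (∀ j, X j) → ℝ≥0∞} (hf : Measurable f) :
    ∫⁻ x, ∫⁻ a, f (Function.update x i a) ∂(μ i) ∂(Measure.pi μ) = ∫⁻ x, f x ∂(Measure.pi μ) := by
  rw [← (measurePreserving_update (μ := μ) i).lintegral_comp hf]
  exact (lintegral_prod _ (hf.comp measurable_update').aemeasurable).symm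

lemma ae_memLp_comp_update (i : ι) {f : (∀ j, X j) → ℝ}
    (hf : MemLp f 2 (Measure.pi μ)) :
    ∀ᵐ x ∂(Measure.pi μ), MemLp (fun a => f (Function.update x i a)) 2 (μ i) := by
  have hup := measurePreserving_update (μ := μ) i
  have hcomp := hf.comp_measurePreserving hup
  filter_upwards [hcomp.aestronglyMeasurable.prodMk_left, hcomp.integrable_sq.prod_right_ae]
    with x hmeas hsq
  exact (memLp_two_iff_integrable_sq hmeas).2 hsq

lemma lintegral_evariance_update (i : ι) {f : (∀ j, X j) → ℝ} (hf : StronglyMeasurable f)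
    (hfi : Integrable f (Measure.pi μ)) :
    ∫⁻ x, evariance (fun a => f (Function.update x i a)) (μ i) ∂(Measure.pi μ) =
      eLpNorm (f - (Measure.pi μ)[f | cylinderEvents {i}ᶜ]) 2 (Measure.pi μ) ^ 2 := by
  have hAm : StronglyMeasurable (partialAvg μ {i}ᶜ f) :=
    (stronglyMeasurable_partialAvg hf).mono cylinderEvents_le_pi
  rw [eLpNorm_congr_ae (EventuallyEq.rfl.sub (condExp_cylinderEvents_ae_eq_partialAvg hf hfi)),
    eLpNorm_two_sq, ← lintegral_lintegral_update i ((hf.sub hAm).measurable.enorm.pow_const 2)]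
  simp only [evariance, Pi.sub_apply, partialAvg_compl_singleton hf, Function.update_idem]

end ProductVariance

lemma absolutelyContinuous_pi_fin {n : ℕ} {X : Fin n → Type*} [∀ i, MeasurableSpace (X i)]
    {μ ν : ∀ i, Measure (X i)} [∀ i, SigmaFinite (μ i)] [∀ i, SigmaFinite (ν i)]
    (h : ∀ i, μ i ≪ ν i) : Measure.pi μ ≪ Measure.pi ν := by
  induction n with
  | zero => rw [Measure.pi_of_empty, Measure.pi_of_empty]
  | succ n ih =>
    have hμ := (measurePreserving_piFinSuccAbove μ 0).symm
    have hν := (measurePreserving_piFinSuccAbove ν 0).symm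
    rw [← hμ.map_eq, ← hν.map_eq]
    exact ((h 0).prod (ih fun i => h _)).map (MeasurableEquiv.measurable _)

/-- The law on `ℝ^ι` of independent centred Gaussian coordinates of variance `v`. -/
noncomputable abbrev gaussianPi (ι : Type*) [Fintype ι] (v : ℝ≥0) : Measure (ι → ℝ) :=
  Measure.pi fun _ => gaussianReal 0 v

lemma gaussianPi_absolutelyContinuous_volume {n : ℕ} {v : ℝ≥0} (hv : v ≠ 0) :
    gaussianPi (Fin n) v ≪ volume :=
  absolutelyContinuous_pi_fin fun _ => gaussianReal_absolutelyContinuous 0 hv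

lemma volume_absolutelyContinuous_gaussianPi {n : ℕ} {v : ℝ≥0} (hv : v ≠ 0) :
    volume ≪ gaussianPi (Fin n) v :=
  absolutelyContinuous_pi_fin fun _ => gaussianReal_absolutelyContinuous' 0 hv

lemma IsAEPrimitive.comp_add_right {f g : ℝ → ℝ} (h : IsAEPrimitive f g) (b : ℝ) :
    IsAEPrimitive (fun t => f (t + b)) (fun t => g (t + b)) := by
  obtain ⟨hg, c, hc⟩ := id h
  refine ⟨locallyIntegrable_comp_add_right hg b, c + ∫ s in (0 : ℝ)..b, g s, ?_⟩
  filter_upwards [(measurePreserving_add_right volume b).quasiMeasurePreserving.ae hc] with t ht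
  rw [ht, intervalIntegral.integral_comp_add_right, zero_add, add_assoc,
    intervalIntegral.integral_add_adjacent_intervals (h.intervalIntegrable _ _)
      (h.intervalIntegrable _ _)]

lemma IsAEPrimitive.sub_const_mul_id {f g : ℝ → ℝ} (h : IsAEPrimitive f g) (k : ℝ) :
    IsAEPrimitive (fun t => f t - k * t) (fun t => g t - k) := by
  obtain ⟨hg, c, hc⟩ := id h
  refine ⟨hg.sub (locallyIntegrable_const k), c, ?_⟩
  filter_upwards [hc] with t ht
  rw [ht, intervalIntegral.integral_sub (h.intervalIntegrable 0 t) intervalIntegrable_const,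
    intervalIntegral.integral_const, sub_zero, smul_eq_mul]
  ring

/-- `G` is the weak derivative of `F` along almost every line parallel to the `i`-th axis, the line
being drawn through a point distributed according to `gaussianPi ι v`. -/
def IsAECoordDeriv {ι : Type*} [Fintype ι] [DecidableEq ι] (v : ℝ≥0) (i : ι)
    (F G : (ι → ℝ) → ℝ) : Prop :=
  ∀ᵐ x ∂gaussianPi ι v,
    IsAEPrimitive (fun a => F (Function.update x i a)) (fun a => G (Function.update x i a))

lemma IsWeakPartialDeriv.isAECoordDeriv {n : ℕ} {v : ℝ≥0} (hv : v ≠ 0) {l : Fin n}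
    {F G : (Fin n → ℝ) → ℝ} (hF : Measurable F) (hG : Measurable G)
    (h : IsWeakPartialDeriv l 1 F G) : IsAECoordDeriv v l F G := by
  have hline : IsWeakLineDeriv volume (Pi.single l 1) F G :=
    ⟨h.1, h.2.1, fun φ hφ hφc => by simpa [partialDeriv] using h.2.2 φ hφ hφc⟩
  have hupdate (x : Fin n → ℝ) (a : ℝ) :
      x + (a + -x l) • Pi.single l 1 = Function.update x l a := by
    ext j
    by_cases hj : j = l
    · subst hj; simp
    · simp [hj]
  filter_upwards [(gaussianPi_absolutelyContinuous_volume hv).ae_le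
    (hline.ae_isAEPrimitive hF hG)] with x hx
  simpa only [hupdate] using hx.comp_add_right (-x l)

variable {ι : Type*} [Fintype ι] [DecidableEq ι] {v : ℝ≥0} {i : ι} {F G K : (ι → ℝ) → ℝ}

lemma IsAECoordDeriv.sub_mul_coord (h : IsAECoordDeriv v i F G)
    (hK : ∀ x a, K (Function.update x i a) = K x) :
    IsAECoordDeriv v i (F - K * fun x => x i) (G - K) := by
  filter_upwards [h] with x hx
  simpa [hK] using hx.sub_const_mul_id (K x)

theorem eLpNorm_sub_condExp_compl_singleton_sq_le (hv : v ≠ 0) (hFm : Measurable F)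
    (hF : MemLp F 2 (gaussianPi ι v)) (hG : Measurable G) (h : IsAECoordDeriv v i F G) :
    eLpNorm (F - (gaussianPi ι v)[F | cylinderEvents {i}ᶜ]) 2 (gaussianPi ι v) ^ 2
      ≤ v * eLpNorm G 2 (gaussianPi ι v) ^ 2 := by
  rw [← lintegral_evariance_update i hFm.stronglyMeasurable (hF.integrable one_le_two),
    eLpNorm_two_sq, ← lintegral_lintegral_update i (hG.enorm.pow_const 2),
    ← lintegral_const_mul' _ _ ENNReal.coe_ne_top]
  refine lintegral_mono_ae ?_
  filter_upwards [h, ae_memLp_comp_update i hF] with x hx hFx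
  exact evariance_gaussianReal_le hv hFx (hG.comp (measurable_update x)) hx

end CoordinatePoincare

section CoordinateRemainder

lemma apply_update_of_stronglyMeasurable_cylinderEvents {ι : Type*} [DecidableEq ι]
    {X : ι → Type*} [∀ i, MeasurableSpace (X i)] {i : ι} {K : (∀ j, X j) → ℝ}
    (hK : StronglyMeasurable[cylinderEvents {i}ᶜ] K) (x : ∀ j, X j) (a : X i) :
    K (Function.update x i a) = K x := by
  have hmem := piecewise_mem_iff_of_measurableSet_cylinderEvents
    (hK.measurable (measurableSet_singleton (K x))) x (Function.update x i a)
  rw [@compl_singleton_piecewise_eq_update, Function.update_self] at hmem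
  exact hmem.2 rfl

variable {ι : Type*} [Fintype ι] {v : ℝ≥0} {i : ι} {s : Set ι} {F G G' K : (ι → ℝ) → ℝ}

lemma memLp_coord (i : ι) : MemLp (fun x => x i) 2 (gaussianPi ι v) :=
  (memLp_id_gaussianReal 2).comp_measurePreserving (measurePreserving_eval _ i)

lemma condExp_coord_ae_eq_zero (hi : i ∉ s) :
    (gaussianPi ι v)[fun x => x i | cylinderEvents s] =ᵐ[gaussianPi ι v] 0 := by
  classical
  refine (condExp_cylinderEvents_ae_eq_partialAvg (measurable_pi_apply i).stronglyMeasurable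
    ((memLp_coord i).integrable one_le_two)).trans (ae_of_all _ fun x => ?_)
  simp only [partialAvg, Set.piecewise_eq_of_notMem _ _ _ hi, Pi.zero_apply]
  exact (integral_comp_of_measurePreserving
    (measurePreserving_eval (fun _ : ι => gaussianReal 0 v) i) aestronglyMeasurable_id).trans
    integral_id_gaussianReal

lemma condExp_mul_coord_ae_eq_zero (hi : i ∉ s) (hK : StronglyMeasurable[cylinderEvents s] K)
    (hK₂ : MemLp K 2 (gaussianPi ι v)) :
    (gaussianPi ι v)[K * fun x => x i | cylinderEvents s] =ᵐ[gaussianPi ι v] 0 := by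
  filter_upwards [condExp_mul_of_stronglyMeasurable_left hK
    (hK₂.integrable_mul (memLp_coord i)) ((memLp_coord i).integrable one_le_two),
    condExp_coord_ae_eq_zero (v := v) hi] with x hmul hcoord
  simp [hmul, hcoord]

lemma memLp_mul_coord (hK : StronglyMeasurable[cylinderEvents {i}ᶜ] K)
    (hK₂ : MemLp K 2 (gaussianPi ι v)) : MemLp (K * fun x => x i) 2 (gaussianPi ι v) := by
  classical
  have hmeas : AEStronglyMeasurable (K * fun x => x i) (gaussianPi ι v) :=
    hK₂.1.mul (memLp_coord i).1
  have hup := measurePreserving_update (μ := fun _ : ι => gaussianReal 0 v) i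
  refine (memLp_two_iff_integrable_sq hmeas).2 ((hup.integrable_comp (hmeas.pow 2)).1 ?_)
  refine (hK₂.integrable_sq.mul_prod (memLp_id_gaussianReal 2).integrable_sq).congr
    (ae_of_all _ fun p => ?_)
  simp [apply_update_of_stronglyMeasurable_cylinderEvents hK, mul_pow]

/-- The error of the first-order approximation of `F` in the `i`-th coordinate, the other
coordinates being frozen. -/
noncomputable def coordRemainder (v : ℝ≥0) (i : ι) (F G : (ι → ℝ) → ℝ) : (ι → ℝ) → ℝ :=
  F - (gaussianPi ι v)[F | cylinderEvents {i}ᶜ]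
    - (gaussianPi ι v)[G | cylinderEvents {i}ᶜ] * fun x => x i

theorem eLpNorm_coordRemainder_sq_le [DecidableEq ι] (hv : v ≠ 0) (hFm : Measurable F)
    (hF : MemLp F 2 (gaussianPi ι v)) (hGm : Measurable G) (hG : MemLp G 2 (gaussianPi ι v))
    (hG' : Measurable G') (hFG : IsAECoordDeriv v i F G) (hGG' : IsAECoordDeriv v i G G') :
    eLpNorm (coordRemainder v i F G) 2 (gaussianPi ι v) ^ 2
      ≤ v ^ 2 * eLpNorm G' 2 (gaussianPi ι v) ^ 2 := by
  unfold coordRemainder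
  set γ := gaussianPi ι v
  set K := γ[G | cylinderEvents {i}ᶜ]
  have hK : StronglyMeasurable[cylinderEvents {i}ᶜ] K := stronglyMeasurable_condExp
  have hKm : Measurable K := (hK.mono cylinderEvents_le_pi).measurable
  have hKx : MemLp (K * fun x => x i) 2 γ := memLp_mul_coord hK (hG.condExp one_le_two)
  have hzero : γ[K * fun x => x i | cylinderEvents {i}ᶜ] =ᵐ[γ] 0 :=
    condExp_mul_coord_ae_eq_zero (not_not.2 (Set.mem_singleton i)) hK (hG.condExp one_le_two)
  have hcentre : F - γ[F | cylinderEvents {i}ᶜ] - K * (fun x => x i) =ᵐ[γ]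
      (F - K * fun x => x i) - γ[F - K * fun x => x i | cylinderEvents {i}ᶜ] := by
    filter_upwards [condExp_sub (hF.integrable one_le_two) (hKx.integrable one_le_two)
      (cylinderEvents {i}ᶜ), hzero] with x hsub hzero
    simp only [Pi.sub_apply, hsub, hzero, Pi.zero_apply]
    ring
  calc eLpNorm (F - γ[F | cylinderEvents {i}ᶜ] - K * fun x => x i) 2 γ ^ 2
      ≤ v * eLpNorm (G - K) 2 γ ^ 2 := by
        rw [eLpNorm_congr_ae hcentre]
        exact eLpNorm_sub_condExp_compl_singleton_sq_le hv
          (hFm.sub (hKm.mul (measurable_pi_apply i))) (hF.sub hKx) (hGm.sub hKm)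
          (hFG.sub_mul_coord (apply_update_of_stronglyMeasurable_cylinderEvents hK))
    _ ≤ v * (v * eLpNorm G' 2 γ ^ 2) := by
        gcongr
        exact eLpNorm_sub_condExp_compl_singleton_sq_le hv hGm hG hG' hGG'
    _ = v ^ 2 * eLpNorm G' 2 γ ^ 2 := by ring

end CoordinateRemainder

section ClarkOconeDecomposition

/-- The σ-algebra on `ℝ^N` generated by the first `k` coordinates. -/
abbrev pastEvents (N k : ℕ) : MeasurableSpace (Fin N → ℝ) :=
  cylinderEvents {j : Fin N | (j : ℕ) < k}

lemma pastEvents_self (N : ℕ) : pastEvents N N = MeasurableSpace.pi := by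
  rw [pastEvents, Set.eq_univ_of_forall (s := {j : Fin N | (j : ℕ) < N}) fun j => j.2,
    cylinderEvents_univ]

variable {N : ℕ} {v : ℝ≥0} {F : (Fin N → ℝ) → ℝ} {l : Fin N}

lemma stronglyMeasurable_coord {k : ℕ} (hlk : l < k) :
    StronglyMeasurable[pastEvents N k] fun x => x l :=
  (measurable_cylinderEvent_apply (Δ := {j : Fin N | (j : ℕ) < k}) hlk).stronglyMeasurable

/-- The error of the first-order approximation of the `l`-th martingale increment
`E[F | 𝒢_{l+1}] - E[F | 𝒢_l]` of `F`. -/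
noncomputable def stepRemainder (v : ℝ≥0) (l : Fin N) (F G : (Fin N → ℝ) → ℝ) :
    (Fin N → ℝ) → ℝ :=
  (gaussianPi (Fin N) v)[F | pastEvents N (l + 1)] - (gaussianPi (Fin N) v)[F | pastEvents N l]
    - (gaussianPi (Fin N) v)[G | pastEvents N l] * fun x => x l

lemma stepRemainder_ae_eq_condExp_coordRemainder {G : (Fin N → ℝ) → ℝ} (hFm : Measurable F)
    (hF : MemLp F 2 (gaussianPi (Fin N) v)) (hGm : Measurable G)
    (hG : MemLp G 2 (gaussianPi (Fin N) v)) :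
    stepRemainder v l F G =ᵐ[gaussianPi (Fin N) v]
      (gaussianPi (Fin N) v)[coordRemainder v l F G | pastEvents N (l + 1)] := by
  unfold stepRemainder coordRemainder
  set γ := gaussianPi (Fin N) v
  have hinter : {j : Fin N | (j : ℕ) < l + 1} ∩ {l}ᶜ = {j : Fin N | (j : ℕ) < l} := by
    ext j
    simp only [Set.mem_inter_iff, Set.mem_ofPred_eq, Set.mem_compl_singleton_iff, ne_eq,
      Fin.ext_iff]
    omega
  have hproj {H : (Fin N → ℝ) → ℝ} (hHm : Measurable H) (hH : MemLp H 2 γ) :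
      γ[γ[H | cylinderEvents {l}ᶜ] | pastEvents N (l + 1)] =ᵐ[γ] γ[H | pastEvents N l] := by
    have h := condExp_cylinderEvents_condExp_cylinderEvents (s := {j : Fin N | (j : ℕ) < l + 1})
      (t := {l}ᶜ) hHm.stronglyMeasurable (hH.integrable one_le_two)
    rwa [hinter] at h
  have hKx : Integrable (γ[G | cylinderEvents {l}ᶜ] * fun x => x l) γ :=
    (hG.condExp one_le_two).integrable_mul (memLp_coord l)
  have hdiff : Integrable (F - γ[F | cylinderEvents {l}ᶜ]) γ :=
    (hF.integrable one_le_two).sub integrable_condExp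
  filter_upwards [hproj hFm hF, hproj hGm hG,
    condExp_sub (g := γ[F | cylinderEvents {l}ᶜ]) (hF.integrable one_le_two) integrable_condExp
      (pastEvents N (l + 1)),
    condExp_sub hdiff hKx (pastEvents N (l + 1)),
    condExp_mul_of_stronglyMeasurable_right (stronglyMeasurable_coord (Nat.lt_add_one (l : ℕ))) hKx
      integrable_condExp]
    with x hFx hGx hsub hsub' hmul
  simp only [hsub', Pi.sub_apply, hsub, hmul, Pi.mul_apply, hFx, hGx]

lemma memLp_condExp_mul_coord {G : (Fin N → ℝ) → ℝ} (hG : MemLp G 2 (gaussianPi (Fin N) v)) :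
    MemLp ((gaussianPi (Fin N) v)[G | pastEvents N l] * fun x => x l) 2 (gaussianPi (Fin N) v) := by
  have hpast : {j : Fin N | (j : ℕ) < l} ⊆ {l}ᶜ := by
    rintro j hj rfl
    exact lt_irrefl _ (Set.mem_ofPred.1 hj)
  exact memLp_mul_coord (stronglyMeasurable_condExp.mono (cylinderEvents_mono hpast))
    (hG.condExp one_le_two)

lemma memLp_stepRemainder {G : (Fin N → ℝ) → ℝ} (hF : MemLp F 2 (gaussianPi (Fin N) v))
    (hG : MemLp G 2 (gaussianPi (Fin N) v)) :
    MemLp (stepRemainder v l F G) 2 (gaussianPi (Fin N) v) :=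
  ((hF.condExp one_le_two).sub (hF.condExp one_le_two)).sub (memLp_condExp_mul_coord hG)

lemma stronglyMeasurable_stepRemainder {k : ℕ} (hlk : l < k) (F G : (Fin N → ℝ) → ℝ) :
    StronglyMeasurable[pastEvents N k] (stepRemainder v l F G) := by
  have hmono {n : ℕ} (hn : n ≤ k) : pastEvents N n ≤ pastEvents N k :=
    cylinderEvents_mono fun _ hj => lt_of_lt_of_le hj hn
  exact ((stronglyMeasurable_condExp.mono (hmono hlk)).sub
    (stronglyMeasurable_condExp.mono (hmono hlk.le))).sub
    ((stronglyMeasurable_condExp.mono (hmono hlk.le)).mul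
      (stronglyMeasurable_coord hlk))

lemma condExp_stepRemainder_ae_eq_zero {G : (Fin N → ℝ) → ℝ}
    (hG : MemLp G 2 (gaussianPi (Fin N) v)) :
    (gaussianPi (Fin N) v)[stepRemainder v l F G | pastEvents N l] =ᵐ[gaussianPi (Fin N) v] 0 := by
  unfold stepRemainder
  set γ := gaussianPi (Fin N) v
  have hle : pastEvents N l ≤ pastEvents N (l + 1) :=
    cylinderEvents_mono fun j (hj : (j : ℕ) < l) => Nat.lt_succ_of_lt hj
  have htower : γ[γ[F | pastEvents N (l + 1)] | pastEvents N l] =ᵐ[γ] γ[F | pastEvents N l] :=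
    condExp_condExp_of_le hle cylinderEvents_le_pi
  have hself : γ[γ[F | pastEvents N l] | pastEvents N l] = γ[F | pastEvents N l] :=
    condExp_of_stronglyMeasurable cylinderEvents_le_pi stronglyMeasurable_condExp
      integrable_condExp
  have hzero : γ[γ[G | pastEvents N l] * fun x => x l | pastEvents N l] =ᵐ[γ] 0 :=
    condExp_mul_coord_ae_eq_zero (by simp) stronglyMeasurable_condExp (hG.condExp one_le_two)
  have hdiff : Integrable (γ[F | pastEvents N (l + 1)] - γ[F | pastEvents N l]) γ :=
    integrable_condExp.sub integrable_condExp
  filter_upwards [htower, condExp_sub (f := γ[F | pastEvents N (l + 1)])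
      (g := γ[F | pastEvents N l]) integrable_condExp integrable_condExp (pastEvents N l),
    condExp_sub hdiff ((memLp_condExp_mul_coord hG).integrable one_le_two) (pastEvents N l),
    hzero] with x htower hsub hsub' hmul
  rw [hsub', Pi.sub_apply, hsub, Pi.sub_apply, htower, hself, hmul]
  simp

/-- The first-order discrete Clark–Ocone approximation of `F` on the Gaussian space `ℝ^N`, where
`G l` stands for `∂_l F`. -/
noncomputable def gaussianClarkOcone (v : ℝ≥0) (F : (Fin N → ℝ) → ℝ)
    (G : Fin N → (Fin N → ℝ) → ℝ) (x : Fin N → ℝ) : ℝ :=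
  ∫ y, F y ∂(gaussianPi (Fin N) v) + ∑ l, ((gaussianPi (Fin N) v)[G l | pastEvents N l]) x * x l

lemma memLp_gaussianClarkOcone (F : (Fin N → ℝ) → ℝ) {G : Fin N → (Fin N → ℝ) → ℝ}
    (hG : ∀ l, MemLp (G l) 2 (gaussianPi (Fin N) v)) :
    MemLp (gaussianClarkOcone v F G) 2 (gaussianPi (Fin N) v) := by
  have hsum : MemLp (fun x => ∑ l, ((gaussianPi (Fin N) v)[G l | pastEvents N l]) x * x l) 2
      (gaussianPi (Fin N) v) :=
    memLp_finsetSum Finset.univ fun l _ => memLp_condExp_mul_coord (hG l)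
  exact (memLp_const (∫ y, F y ∂(gaussianPi (Fin N) v))).add hsum

lemma sub_gaussianClarkOcone_eq_sum_stepRemainder {G : Fin N → (Fin N → ℝ) → ℝ} (hFm : Measurable F)
    (hF : Integrable F (gaussianPi (Fin N) v)) :
    F - gaussianClarkOcone v F G =
      ∑ l, stepRemainder v l F (G l) := by
  set γ := gaussianPi (Fin N) v
  have hstart : γ[F | pastEvents N 0] = fun _ => ∫ y, F y ∂γ := by
    have hbot : pastEvents N 0 = ⊥ := by simp [pastEvents, cylinderEvents]
    rw [hbot, condExp_bot]
  have hend : γ[F | pastEvents N N] = F := by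
    rw [pastEvents_self]
    exact condExp_of_stronglyMeasurable le_rfl hFm.stronglyMeasurable hF
  have htelescope : ∑ l : Fin N, (γ[F | pastEvents N (l + 1)] - γ[F | pastEvents N l]) =
      F - fun _ => ∫ y, F y ∂γ := by
    rw [Fin.sum_univ_eq_sum_range (fun k => γ[F | pastEvents N (k + 1)] - γ[F | pastEvents N k]),
      Finset.sum_range_sub fun k => γ[F | pastEvents N k], hstart, hend]
  simp only [stepRemainder, Finset.sum_sub_distrib] at htelescope ⊢
  rw [htelescope]
  ext x
  simp only [gaussianClarkOcone, Pi.sub_apply, Finset.sum_apply, Pi.mul_apply]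
  ring

theorem eLpNorm_sub_gaussianClarkOcone_sq_le (hv : v ≠ 0) {G G' : Fin N → (Fin N → ℝ) → ℝ}
    (hFm : Measurable F) (hF : MemLp F 2 (gaussianPi (Fin N) v)) (hGm : ∀ l, Measurable (G l))
    (hG : ∀ l, MemLp (G l) 2 (gaussianPi (Fin N) v)) (hG' : ∀ l, Measurable (G' l))
    (hFG : ∀ l, IsAECoordDeriv v l F (G l)) (hGG' : ∀ l, IsAECoordDeriv v l (G l) (G' l)) :
    eLpNorm (F - gaussianClarkOcone v F G) 2 (gaussianPi (Fin N) v) ^ 2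
      ≤ v ^ 2 * ∑ l, eLpNorm (G' l) 2 (gaussianPi (Fin N) v) ^ 2 := by
  set γ := gaussianPi (Fin N) v
  have hstep (l : Fin N) :
      eLpNorm (stepRemainder v l F (G l)) 2 γ ≤ eLpNorm (coordRemainder v l F (G l)) 2 γ := by
    rw [eLpNorm_congr_ae (stepRemainder_ae_eq_condExp_coordRemainder hFm hF (hGm l) (hG l))]
    exact eLpNorm_condExp_le_eLpNorm _ one_le_two
  rw [sub_gaussianClarkOcone_eq_sum_stepRemainder hFm (hF.integrable one_le_two),
    eLpNorm_sum_sq_of_condExp_eq_zero (m := fun l : Fin N => pastEvents N l)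
      (fun _ => cylinderEvents_le_pi) (fun l => memLp_stepRemainder hF (hG l))
      (fun l k hlk => (stronglyMeasurable_stepRemainder hlk F (G l)).aestronglyMeasurable)
      (fun l => condExp_stepRemainder_ae_eq_zero (hG l)), Finset.mul_sum]
  gcongr with l
  exact (pow_le_pow_left' (hstep l) 2).trans
    (eLpNorm_coordRemainder_sq_le hv hFm hF (hGm l) (hG l) (hG' l) (hFG l) (hGG' l))

end ClarkOconeDecomposition

section WeakPartialDeriv

variable {N : ℕ} {l : Fin N} {m : ℕ}

lemma IsWeakPartialDeriv.congr_ae_left {F F' G : (Fin N → ℝ) → ℝ} (h : IsWeakPartialDeriv l m F G)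
    (hF : F =ᵐ[volume] F') : IsWeakPartialDeriv l m F' G :=
  ⟨h.1.congr hF, h.2.1, fun φ hφ hφc =>
    (integral_congr_ae (hF.symm.mul (EventuallyEq.refl _ _))).trans (h.2.2 φ hφ hφc)⟩

lemma contDiff_partialDeriv {φ : (Fin N → ℝ) → ℝ} (hφ : ContDiff ℝ ((⊤ : ℕ∞) : WithTop ℕ∞) φ) :
    ContDiff ℝ ((⊤ : ℕ∞) : WithTop ℕ∞) (partialDeriv l φ) :=
  (hφ.fderiv_right (by simp)).clm_apply contDiff_const

lemma hasCompactSupport_partialDeriv {φ : (Fin N → ℝ) → ℝ} (hφ : HasCompactSupport φ) :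
    HasCompactSupport (partialDeriv l φ) :=
  hφ.fderiv_apply ℝ (Pi.single l 1)

lemma IsWeakPartialDeriv.of_succ {F G G' : (Fin N → ℝ) → ℝ}
    (hG : IsWeakPartialDeriv l m F G) (hG' : IsWeakPartialDeriv l (m + 1) F G') :
    IsWeakPartialDeriv l 1 G G' := by
  refine ⟨hG.2.1, hG'.2.1, fun φ hφ hφc => ?_⟩
  have h := hG.2.2 _ (contDiff_partialDeriv (l := l) hφ) (hasCompactSupport_partialDeriv hφc)
  have h' := hG'.2.2 φ hφ hφc
  rw [Function.iterate_succ_apply, h, pow_succ, mul_assoc] at h'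
  simpa using mul_left_cancel₀ (pow_ne_zero m (by simp)) h'

end WeakPartialDeriv

section Grid

variable {T : ℝ} {N k : ℕ}

lemma gridPoint_succ_sub_gridPoint (T : ℝ) (N k : ℕ) :
    gridPoint T N (k + 1) - gridPoint T N k = T / N := by
  simp only [gridPoint]
  push_cast
  ring

lemma monotone_gridPoint (hT : 0 ≤ T) (N : ℕ) : Monotone (gridPoint T N) := by
  intro a b hab
  unfold gridPoint
  gcongr

lemma gridPoint_mem_Icc (hT : 0 ≤ T) (hN : N ≠ 0) (hk : k ≤ N) :
    gridPoint T N k ∈ Set.Icc 0 T := by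
  have hzero : gridPoint T N 0 = 0 := by simp [gridPoint]
  have hend : gridPoint T N N = T := mul_div_cancel_left₀ T (Nat.cast_ne_zero.2 hN)
  exact ⟨hzero ▸ monotone_gridPoint hT N (Nat.zero_le k),
    (monotone_gridPoint hT N hk).trans_eq hend⟩

end Grid

section Increments

/-- The vector `(ΔW_1, …, ΔW_N)` of all increments. -/
noncomputable def incrVec {Ω : Type*} (T : ℝ) (W : ℝ → Ω → ℝ) (N : ℕ) (ω : Ω) : Fin N → ℝ :=
  fun j => incr T W N j ω

lemma sigmaIncr_eq_comap_pastEvents {Ω : Type*} (T : ℝ) (W : ℝ → Ω → ℝ) (N k : ℕ) :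
    sigmaIncr T W N k = (pastEvents N k).comap (incrVec T W N) := by
  simp only [sigmaIncr, pastEvents, cylinderEvents, MeasurableSpace.comap_iSup,
    MeasurableSpace.comap_comp, Set.mem_ofPred_eq]
  rfl

lemma measurePreserving_incrVec {Ω : Type*} [MeasurableSpace Ω] {P : Measure Ω}
    {T : ℝ} {W : ℝ → Ω → ℝ} {N : ℕ} [IsProbabilityMeasure P] (hT : 0 ≤ T)
    (hW : IsBrownianMotionOn T W P) (hN : N ≠ 0) :
    MeasurePreserving (incrVec T W N) P (gaussianPi (Fin N) (T / N).toNNReal) := by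
  have hmem {k : ℕ} (hk : k ≤ N) : gridPoint T N k ∈ Set.Icc 0 T := gridPoint_mem_Icc hT hN hk
  have hlaw (l : Fin N) : HasLaw (incr T W N l) (gaussianReal 0 (T / N).toNNReal) P := by
    rw [← gridPoint_succ_sub_gridPoint T N l]
    exact hW.law_increments _ _ (hmem l.2.le).1 (monotone_gridPoint hT N (Nat.le_succ l))
      (hmem l.2).2
  have hindep : iIndepFun (incr T W N) P :=
    hW.indep_increments N (fun i => ⟨gridPoint T N i, hmem (Nat.lt_succ_iff.1 i.2)⟩)
      fun _ _ hij => monotone_gridPoint hT N hij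
  exact ⟨measurable_pi_iff.2 fun l =>
    (hW.measurable _ (hmem l.2)).sub (hW.measurable _ (hmem l.2.le)),
    ((iIndepFun_iff_hasLaw_pi_pi hlaw).1 hindep).map_eq⟩

end Increments

section Representatives

variable {Ω : Type*} [MeasurableSpace Ω] {P : Measure Ω} {T : ℝ} {W : ℝ → Ω → ℝ} {N : ℕ}
  {ν : Measure (Fin N → ℝ)} {X : Ω → ℝ} {l : Fin N} {m n : ℕ}

lemma ae_eq_of_comp_ae_eq_comp {α β : Type*} [MeasurableSpace α] [MeasurableSpace β]
    {μ : Measure α} {ν : Measure β} {V : α → β} (hV : MeasurePreserving V μ ν) {f g : β → ℝ}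
    (hf : Measurable f) (hg : Measurable g) (h : f ∘ V =ᵐ[μ] g ∘ V) : f =ᵐ[ν] g := by
  rw [← hV.map_eq]
  exact (ae_map_iff hV.aemeasurable (measurableSet_eq_fun hf hg)).2 h

lemma memLp_of_ae_eq_comp {α β : Type*} [MeasurableSpace α] [MeasurableSpace β]
    {μ : Measure α} {ν : Measure β} {V : α → β} (hV : MeasurePreserving V μ ν) {f : β → ℝ}
    {g : α → ℝ} {p : ℝ≥0∞} (hf : Measurable f) (hg : MemLp g p μ) (h : g =ᵐ[μ] f ∘ V) :
    MemLp f p ν := by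
  rw [← hV.map_eq, memLp_map_measure_iff hf.aestronglyMeasurable hV.aemeasurable]
  exact hg.ae_eq h

lemma MemD.mono (hX : MemD T W P N n X) (hmn : m ≤ n) : MemD T W P N m X :=
  ⟨hX.1, hX.2.1, fun l k hk hkm => hX.2.2 l k hk (hkm.trans hmn)⟩

lemma MemD.exists_ae_eq_comp (hX : MemD T W P N n X)
    (hV : MeasurePreserving (incrVec T W N) P ν) :
    ∃ F : (Fin N → ℝ) → ℝ, Measurable F ∧ MemLp F 2 ν ∧ X =ᵐ[P] F ∘ incrVec T W N := by
  obtain ⟨hX₂, ⟨Y, hY, hXY⟩, -⟩ := hX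
  rw [sigmaIncr_eq_comap_pastEvents, pastEvents_self] at hY
  obtain ⟨F, hF, rfl⟩ := hY.exists_eq_measurable_comp
  exact ⟨F, hF.measurable, memLp_of_ae_eq_comp hV hF.measurable hX₂ hXY, hXY⟩

lemma MemD.exists_functionalDeriv_ae_eq_comp (hX : MemD T W P N n X)
    (hV : MeasurePreserving (incrVec T W N) P ν) (hν : volume ≪ ν) (l : Fin N) (hm : 1 ≤ m)
    (hmn : m ≤ n) {F : (Fin N → ℝ) → ℝ} (hF : Measurable F) (hXF : X =ᵐ[P] F ∘ incrVec T W N) :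
    ∃ G : (Fin N → ℝ) → ℝ, Measurable G ∧ MemLp G 2 ν ∧
      functionalDeriv T W P l m X =ᵐ[P] G ∘ incrVec T W N ∧ IsWeakPartialDeriv l m F G := by
  have hex := hX.2.2 l m hm hmn
  obtain ⟨hY, H, G, hHm, hGm, hXH, hYG, hderiv⟩ :
      MemLp (functionalDeriv T W P l m X) 2 P ∧
        IsFunctionalDeriv T W P l m X (functionalDeriv T W P l m X) := by
    rw [functionalDeriv, dif_pos hex]
    exact hex.choose_spec
  have hHF : H =ᵐ[volume] F := hν.ae_le (ae_eq_of_comp_ae_eq_comp hV hHm hF (hXH.symm.trans hXF))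
  exact ⟨G, hGm, memLp_of_ae_eq_comp hV hGm hY hYG, hYG, hderiv.congr_ae_left hHF⟩

end Representatives

section ErrorBound

variable {Ω : Type*} [MeasurableSpace Ω] {P : Measure Ω} [IsProbabilityMeasure P] {T : ℝ}
  {W : ℝ → Ω → ℝ} {N : ℕ} {v : ℝ≥0} {X : Ω → ℝ}

lemma sub_clarkOconeApprox_ae_eq_comp
    (hV : MeasurePreserving (incrVec T W N) P (gaussianPi (Fin N) v))
    {F : (Fin N → ℝ) → ℝ} {G : Fin N → (Fin N → ℝ) → ℝ} (hF : Measurable F)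
    (hXF : X =ᵐ[P] F ∘ incrVec T W N) (hG : ∀ l, Integrable (G l) (gaussianPi (Fin N) v))
    (hXG : ∀ l, functionalDeriv T W P l 1 X =ᵐ[P] G l ∘ incrVec T W N) :
    (fun ω => X ω - clarkOconeApprox T W P N X ω) =ᵐ[P]
      (F - gaussianClarkOcone v F G) ∘ incrVec T W N := by
  have hmean : ∫ ω, X ω ∂P = ∫ y, F y ∂(gaussianPi (Fin N) v) :=
    (integral_congr_ae hXF).trans
      (integral_comp_of_measurePreserving hV hF.aestronglyMeasurable)
  have hcond (l : Fin N) : P[functionalDeriv T W P l 1 X | sigmaIncr T W N l] =ᵐ[P]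
      (gaussianPi (Fin N) v)[G l | pastEvents N l] ∘ incrVec T W N := by
    rw [sigmaIncr_eq_comap_pastEvents]
    exact (condExp_congr_ae (hXG l)).trans
      (condExp_comp_of_measurePreserving hV cylinderEvents_le_pi (hG l))
  filter_upwards [hXF, ae_all_iff.2 hcond] with ω hωF hωG
  simp only [clarkOconeApprox, hωF, hωG, hmean]
  rfl

theorem memLp_sub_clarkOconeApprox (hv : v ≠ 0)
    (hV : MeasurePreserving (incrVec T W N) P (gaussianPi (Fin N) v)) (hX : MemD T W P N 1 X) :
    MemLp (fun ω => X ω - clarkOconeApprox T W P N X ω) 2 P := by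
  obtain ⟨F, hFm, hF, hXF⟩ := hX.exists_ae_eq_comp hV
  choose G _ hG hXG _ using fun l => hX.exists_functionalDeriv_ae_eq_comp hV
    (volume_absolutelyContinuous_gaussianPi hv) l le_rfl le_rfl hFm hXF
  exact ((hF.sub (memLp_gaussianClarkOcone F hG)).comp_measurePreserving hV).ae_eq
    (sub_clarkOconeApprox_ae_eq_comp hV hFm hXF (fun l => (hG l).integrable one_le_two) hXG).symm

theorem eLpNorm_sub_clarkOconeApprox_sq_le_sum (hv : v ≠ 0)
    (hV : MeasurePreserving (incrVec T W N) P (gaussianPi (Fin N) v)) (hX : MemD T W P N 2 X) :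
    eLpNorm (fun ω => X ω - clarkOconeApprox T W P N X ω) 2 P ^ 2
      ≤ v ^ 2 * ∑ l : Fin N, eLpNorm (functionalDeriv T W P l 2 X) 2 P ^ 2 := by
  obtain ⟨F, hFm, hF, hXF⟩ := hX.exists_ae_eq_comp hV
  have hvol := volume_absolutelyContinuous_gaussianPi (n := N) hv
  choose G hGm hG hXG hFG using fun l =>
    hX.exists_functionalDeriv_ae_eq_comp hV hvol l le_rfl one_le_two hFm hXF
  choose G' hGm' hG' hXG' hFG' using fun l =>
    hX.exists_functionalDeriv_ae_eq_comp hV hvol l one_le_two le_rfl hFm hXF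
  have hG'norm (l : Fin N) : eLpNorm (functionalDeriv T W P l 2 X) 2 P =
      eLpNorm (G' l) 2 (gaussianPi (Fin N) v) := by
    rw [eLpNorm_congr_ae (hXG' l), eLpNorm_comp_measurePreserving (hG' l).1 hV]
  rw [eLpNorm_congr_ae (sub_clarkOconeApprox_ae_eq_comp hV hFm hXF
    (fun l => (hG l).integrable one_le_two) hXG),
    eLpNorm_comp_measurePreserving (hF.sub (memLp_gaussianClarkOcone F hG)).1 hV]
  simp only [hG'norm]
  exact eLpNorm_sub_gaussianClarkOcone_sq_le hv hFm hF hGm hG hGm'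
    (fun l => (hFG l).isAECoordDeriv hv hFm (hGm l))
    (fun l => ((hFG l).of_succ (hFG' l)).isAECoordDeriv hv (hGm l) (hGm' l))

end ErrorBound

section Rate

variable {Ω : Type*} [MeasurableSpace Ω] {P : Measure Ω} {T : ℝ} {W : ℝ → Ω → ℝ} {N : ℕ}
  {X : Ω → ℝ}

lemma malliavinDeriv_of_mem_Ico (hT : 0 ≤ T) (m : ℕ) (X : Ω → ℝ) {l : Fin N} {t : ℝ}
    (ht : t ∈ Set.Ico (gridPoint T N l) (gridPoint T N (l + 1))) :
    malliavinDeriv T W P N m X t = functionalDeriv T W P l m X := by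
  ext ω
  rw [malliavinDeriv, Finset.sum_eq_single l, Set.indicator_of_mem ht]
  · intro j _ hj
    exact Set.indicator_of_notMem (Set.disjoint_right.1
      ((monotone_gridPoint hT N).pairwise_disjoint_on_Ico_succ (Fin.val_ne_of_ne hj)) ht) _
  · simp

lemma sum_eLpNorm_functionalDeriv_sq_le (hT : 0 ≤ T) (hN : N ≠ 0) (m : ℕ) (X : Ω → ℝ) :
    (T / N).toNNReal * ∑ l : Fin N, eLpNorm (functionalDeriv T W P l m X) 2 P ^ 2
      ≤ ∫⁻ t in Set.Icc 0 T, eLpNorm (malliavinDeriv T W P N m X t) 2 P ^ 2 := by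
  set cell : Fin N → Set ℝ := fun l => Set.Ico (gridPoint T N l) (gridPoint T N (l + 1))
  have hdisj : Pairwise (Function.onFun Disjoint cell) :=
    (monotone_gridPoint hT N).pairwise_disjoint_on_Ico_succ.comp_of_injective Fin.val_injective
  have hcell (l : Fin N) : cell l ⊆ Set.Icc 0 T := fun t ht =>
    ⟨(gridPoint_mem_Icc hT hN l.2.le).1.trans ht.1,
      ht.2.le.trans (gridPoint_mem_Icc hT hN (Nat.succ_le_of_lt l.2)).2⟩
  calc (T / N).toNNReal * ∑ l : Fin N, eLpNorm (functionalDeriv T W P l m X) 2 P ^ 2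
      = ∑ l : Fin N, ∫⁻ t in cell l, eLpNorm (malliavinDeriv T W P N m X t) 2 P ^ 2 := by
        rw [Finset.mul_sum]
        refine Finset.sum_congr rfl fun l _ => ?_
        rw [setLIntegral_congr_fun measurableSet_Ico fun t ht => by
            rw [malliavinDeriv_of_mem_Ico hT m X ht], setLIntegral_const,
          Real.volume_Ico, gridPoint_succ_sub_gridPoint, mul_comm]
        rfl
    _ = ∫⁻ t in ⋃ l, cell l, eLpNorm (malliavinDeriv T W P N m X t) 2 P ^ 2 := by
        rw [lintegral_iUnion (fun _ => measurableSet_Ico) hdisj, tsum_fintype]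
    _ ≤ _ := lintegral_mono_set (Set.iUnion_subset hcell)

theorem eLpNorm_sub_clarkOconeApprox_sq_le_lintegral [IsProbabilityMeasure P] (hT : 0 < T)
    (hN : N ≠ 0)
    (hV : MeasurePreserving (incrVec T W N) P (gaussianPi (Fin N) (T / N).toNNReal))
    (hX : MemD T W P N 2 X) :
    eLpNorm (fun ω => X ω - clarkOconeApprox T W P N X ω) 2 P ^ 2
      ≤ (T / N).toNNReal *
        ∫⁻ t in Set.Icc 0 T, eLpNorm (malliavinDeriv T W P N 2 X t) 2 P ^ 2 := by
  have hv : (T / N).toNNReal ≠ 0 := (Real.toNNReal_pos.2 (by positivity)).ne'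
  refine (eLpNorm_sub_clarkOconeApprox_sq_le_sum hv hV hX).trans ?_
  rw [sq, mul_assoc]
  gcongr
  exact sum_eLpNorm_functionalDeriv_sq_le hT.le hN 2 X

lemma isBigO_rpow_neg_half_of_sq_le {e : ℕ → ℝ≥0∞} {K : ℝ≥0∞} (hT : 0 ≤ T) (hK : K ≠ ∞)
    (he : ∀ N : ℕ, 1 ≤ N → e N ^ 2 ≤ (T / N).toNNReal * K) :
    (fun N => (e N).toReal) =O[atTop] (fun N : ℕ => (N : ℝ) ^ (-(1 / 2) : ℝ)) := by
  refine Asymptotics.IsBigO.of_bound (Real.sqrt (T * K.toReal)) ?_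
  filter_upwards [eventually_ge_atTop 1] with N hN
  have hsq : (e N).toReal ^ 2 ≤ T * K.toReal * (N : ℝ)⁻¹ := by
    have h := ENNReal.toReal_mono (ENNReal.mul_ne_top ENNReal.coe_ne_top hK) (he N hN)
    rw [ENNReal.toReal_pow, ENNReal.toReal_mul, ENNReal.coe_toReal,
      Real.coe_toNNReal _ (by positivity)] at h
    exact h.trans_eq (by ring)
  rw [Real.norm_of_nonneg ENNReal.toReal_nonneg, Real.norm_of_nonneg (by positivity),
    Real.rpow_neg (Nat.cast_nonneg N), ← Real.sqrt_eq_rpow, ← Real.sqrt_inv,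
    ← Real.sqrt_mul (by positivity)]
  exact Real.le_sqrt_of_sq_le hsq

end Rate

end DiscreteClarkOcone

theorem corollary3p3_general {Ω : Type*} [MeasurableSpace Ω] (P : Measure Ω)
    [IsProbabilityMeasure P] (T : ℝ) (hT : 0 < T) (W : ℝ → Ω → ℝ)
    (hW : ∀ N : ℕ, 1 ≤ N → MeasurePreserving (DiscreteClarkOcone.incrVec T W N) P
      (DiscreteClarkOcone.gaussianPi (Fin N) (T / N).toNNReal))
    (X : ℕ → Ω → ℝ) (hX : ∀ N : ℕ, 1 ≤ N → DiscreteClarkOcone.MemD T W P N 2 (X N))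
    (hsup : (⨆ (N : ℕ) (_ : 1 ≤ N), ∫⁻ t in Set.Icc (0 : ℝ) T,
      (eLpNorm (DiscreteClarkOcone.malliavinDeriv T W P N 2 (X N) t) 2 P) ^ 2) < (∞ : ℝ≥0∞)) :
    (∀ N : ℕ, 1 ≤ N →
      MemLp (fun ω => X N ω - DiscreteClarkOcone.clarkOconeApprox T W P N (X N) ω) 2 P) ∧
    (fun N : ℕ =>
      (eLpNorm (fun ω => X N ω - DiscreteClarkOcone.clarkOconeApprox T W P N (X N) ω) 2 P).toReal)
        =O[atTop] (fun N : ℕ => (N : ℝ) ^ (-(1 / 2) : ℝ)) := by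
  refine ⟨fun N hN => ?_, DiscreteClarkOcone.isBigO_rpow_neg_half_of_sq_le hT.le hsup.ne
    fun N hN => ?_⟩
  · have hv : (T / N).toNNReal ≠ 0 := (Real.toNNReal_pos.2 (by positivity)).ne'
    exact DiscreteClarkOcone.memLp_sub_clarkOconeApprox hv (hW N hN) ((hX N hN).mono one_le_two)
  · have hsup_ge : ∫⁻ t in Set.Icc (0 : ℝ) T,
        (eLpNorm (DiscreteClarkOcone.malliavinDeriv T W P N 2 (X N) t) 2 P) ^ 2 ≤ _ :=
      le_iSup₂ (f := fun (N : ℕ) (_ : 1 ≤ N) => ∫⁻ t in Set.Icc (0 : ℝ) T,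
        (eLpNorm (DiscreteClarkOcone.malliavinDeriv T W P N 2 (X N) t) 2 P) ^ 2) N hN
    exact (DiscreteClarkOcone.eLpNorm_sub_clarkOconeApprox_sq_le_lintegral hT
      (Nat.one_le_iff_ne_zero.1 hN) (hW N hN) (hX N hN)).trans (by gcongr)

theorem corollary3p3 {Ω : Type*} [MeasurableSpace Ω] (P : Measure Ω) [IsProbabilityMeasure P]
    (T : ℝ) (hT : 0 < T) (W : ℝ → Ω → ℝ) (hW : DiscreteClarkOcone.IsBrownianMotionOn T W P)
    (X : ℕ → Ω → ℝ) (hX : ∀ N : ℕ, 1 ≤ N → DiscreteClarkOcone.MemD T W P N 2 (X N))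
    (hsup : (⨆ (N : ℕ) (_ : 1 ≤ N), ∫⁻ t in Set.Icc (0 : ℝ) T,
      (eLpNorm (DiscreteClarkOcone.malliavinDeriv T W P N 2 (X N) t) 2 P) ^ 2) < (∞ : ℝ≥0∞)) :
    (∀ N : ℕ, 1 ≤ N →
      MemLp (fun ω => X N ω - DiscreteClarkOcone.clarkOconeApprox T W P N (X N) ω) 2 P) ∧
    (fun N : ℕ =>
      (eLpNorm (fun ω => X N ω - DiscreteClarkOcone.clarkOconeApprox T W P N (X N) ω) 2 P).toReal)
        =O[atTop] (fun N : ℕ => (N : ℝ) ^ (-(1 / 2) : ℝ)) :=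
  corollary3p3_general P T hT W (fun _ hN => DiscreteClarkOcone.measurePreserving_incrVec hT.le hW
    (Nat.one_le_iff_ne_zero.1 hN)) X hX hsup
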